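/- A game arena is a finite directed graph $(V,E)$ whose vertex set is partitioned into $V_{\mathsf{Eve}}$ and $V_{\mathsf{Adam}}$. A token starts on a vertex $s$; the owner of the current vertex $u$ moves it along an edge to a vertex of $Succ(u)$, as told by a strategy that may depend on the whole history (if $u$ has no successor, the token stays on $u$). In a generalised reachability game $(\mathcal A,s,\{F_0\},T)$ with $F_0\subseteq V$, $|F_0|>1$ and $T=\{t_1,\dots,t_k\}\subseteq V$ (where $k=|T|\ge 0$), the target sets are $F_0,\{t_1\},\dots,\{t_k\}$: all of them except $F_0$ are singletons. Eve wins if she has a strategy such that, against every strategy of Adam, some finite prefix of the play from $s$ contains a vertex of every target set. For $S\subseteq V$ let $\mathsf{Attr}^0(S)=S$, let $$\mathsf{Attr}^{i+1}(S)=\mathsf{Attr}^i(S)\cup\{u\in V_{\mathsf{Eve}}\mid Succ(u)\cap\mathsf{Attr}^i(S)\neq\emptyset\}\cup\{u\in V_{\mathsf{Adam}}\mid Succ(u)\subseteq\mathsf{Attr}^i(S)\},$$ and let $\mathsf{Attr}(S)=\bigcup_i\mathsf{Attr}^i(S)$. 1. The problem to decide, given such a game $(\mathcal A,s,\{F_0\},T)$,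 whether Eve wins is in $\mathsf P$. (The game is given as a bit string: $|V|$ in unary, the characteristic vectors of $V_{\mathsf{Eve}}$, $\{s\}$, $F_0$ and $T$, and the adjacency matrix.) 2. Let $(\mathcal A,s,\{F_0\},T)$ be such a game in which every vertex of Adam has a successor. Then Eve wins if and only if the following three conditions hold: (i) the sets $\mathsf{Attr}(\{t\})$, $t\in T$, form a chain under inclusion; and, for an enumeration $t_1,\dots,t_k$ of $T$ without repetition with $A_k\subseteq\dots\subseteq A_1\subseteq A_0$, where $A_i=\mathsf{Attr}(\{t_i\})$ for $1\le i\le k$ and $A_0=V$, (ii) $s\in A_k$, and (iii) $t_{i+1}\in\mathsf{Attr}(A_i\cap F_0)$ for some $0\le i\le k$, where $t_{k+1}=s$. This holds both if (ii) and (iii) are required for some such enumeration and if they are required for every such enumeration. -/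

import Mathlib

/-! Two-player generalised reachability games on finite graphs. -/

/-- A game arena: a directed graph on the vertex set `V` together with a partition of `V` into
the vertices of Eve (`eve`) and those of Adam (the complement of `eve`). -/
structure GameArena (V : Type*) where
  /-- the edge relation `u → v` -/
  Edge : V → V → Prop
  /-- the vertices controlled by Eve -/
  eve : Set V

namespace GameArena

variable {V : Type*} (A : GameArena V)

/-- The set of successors of a vertex. -/
def succ (u : V) : Set V := {v | A.Edge u v}

/-- The vertices controlled by Adam. -/
def adam : Set V := A.eveᶜ

/-- A strategy of the player who controls the vertices in `P`: it assigns to each word `h v` with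
`h ∈ V*` (the past history) and `v ∈ P` (the current vertex) a successor of `v`. The requirement
is void at a vertex without successors, where no move is possible. -/
structure Strategy (P : Set V) where
  /-- the vertex chosen after the history `h` at the current vertex `v` -/
  move : List V → V → V
  move_mem : ∀ (h : List V) (v : V), v ∈ P → (A.succ v).Nonempty → move h v ∈ A.succ v

open Classical in
/-- The vertex that follows the current vertex `v` after the history `h` when both players use
the given strategies. If `v` has no successor, then the token stays on `v`. -/
noncomputable def nextVertex (σ : A.Strategy A.eve) (τ : A.Strategy A.adam)
    (h : List V) (v : V) : V :=
  if (A.succ v).Nonempty then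
    if v ∈ A.eve then σ.move h v else τ.move h v
  else v

/-- The pair of the history `v₀ … v_{n-1}` and the current vertex `v_n` after `n` steps of
the play from `s` that is induced by a pair of strategies. -/
noncomputable def position (σ : A.Strategy A.eve) (τ : A.Strategy A.adam) (s : V) :
    ℕ → List V × V
  | 0 => ([], s)
  | n + 1 =>
    let p := position σ τ s n
    (p.1 ++ [p.2], A.nextVertex σ τ p.1 p.2)

/-- The play `v₀ v₁ v₂ …` from `s` that is induced by a pair of strategies. -/
noncomputable def play (σ : A.Strategy A.eve) (τ : A.Strategy A.adam) (s : V) (n : ℕ) : V :=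
  (A.position σ τ s n).2

/-- `A.attrStep S i` is the set of vertices from which Eve can force a visit to `S` within
`i` steps. -/
def attrStep (S : Set V) : ℕ → Set V
  | 0 => S
  | i + 1 => attrStep S i
      ∪ {u | u ∈ A.eve ∧ ∃ v ∈ A.succ u, v ∈ attrStep S i}
      ∪ {u | u ∈ A.adam ∧ ∀ v ∈ A.succ u, v ∈ attrStep S i}

/-- The attractor of `S` for Eve. -/
def attr (S : Set V) : Set V := ⋃ i, A.attrStep S i

end GameArena

/-- A generalised reachability game: an arena, a start vertex and a family of target sets. -/
structure GenReachGame (V : Type*) where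
  /-- the arena -/
  arena : GameArena V
  /-- the start vertex -/
  start : V
  /-- the target sets -/
  targets : Finset (Finset V)

/-- Eve has a strategy to visit all target sets from the start vertex: whatever Adam does, some
finite prefix `v₀ … v_k` of the play contains a vertex of each target set. -/
def GenReachGame.EveWins {V : Type*} (G : GenReachGame V) : Prop :=
  ∃ σ : G.arena.Strategy G.arena.eve, ∀ τ : G.arena.Strategy G.arena.adam,
    ∃ k : ℕ, ∀ F ∈ G.targets, ∃ j ≤ k, G.arena.play σ τ G.start j ∈ F

/-- The data of a generalised reachability game in which all target sets are singletons except
for one set `F₀`, which has more than one element. The singleton target sets are given by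
the set `T` of their elements. -/
structure OneLargeTargetGame (V : Type*) where
  /-- the arena -/
  arena : GameArena V
  /-- the start vertex -/
  start : V
  /-- the target set that is not a singleton -/
  F₀ : Finset V
  /-- the elements of the singleton target sets -/
  T : Finset V
  one_lt_card : 1 < F₀.card

namespace OneLargeTargetGame

variable {V : Type*}

open Classical in
/-- The underlying generalised reachability game, with target sets `F₀` and `{t}` for `t ∈ T`. -/
noncomputable def toGenReachGame (G : OneLargeTargetGame V) : GenReachGame V where
  arena := G.arena
  start := G.start
  targets := insert G.F₀ (G.T.image fun t => {t})

/-- Eve wins the game from the start vertex. -/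
def EveWins (G : OneLargeTargetGame V) : Prop := G.toGenReachGame.EveWins

/-- The attractor of the singleton target set `{t}`. -/
def singletonAttr (G : OneLargeTargetGame V) (t : V) : Set V := G.arena.attr {t}

/-- The sets `A₀, A₁, …, A_k` for an enumeration `t₁, …, t_k` of targets: `A₀` is the set of
all vertices, and `A_i` is the attractor of `{t_i}` for `1 ≤ i ≤ k`.
The enumeration is written `e 0, …, e (k - 1)`, that is, `t_{i+1}` is `e i`. -/
def attrSeq (G : OneLargeTargetGame V) {k : ℕ} (e : Fin k → V) : Fin (k + 1) → Set V :=
  Fin.cons (α := fun _ => Set V) Set.univ fun i => G.singletonAttr (e i)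

/-- The vertices `t₁, …, t_k, t_{k+1}` for an enumeration `t₁, …, t_k` of targets, where
`t_{k+1}` is the start vertex. The value at `i` is `t_{i+1}`. -/
def targetSeq (G : OneLargeTargetGame V) {k : ℕ} (e : Fin k → V) : Fin (k + 1) → V :=
  Fin.snoc (α := fun _ => V) e G.start

/-- `e` enumerates the elements of `T` without repetition, as `t₁, …, t_k` with `k = |T|`,
in such a way that `A_k ⊆ … ⊆ A₁ ⊆ A₀`. -/
structure IsDescendingEnumeration (G : OneLargeTargetGame V) (e : Fin G.T.card → V) : Prop where
  injective : Function.Injective e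
  range_eq : Set.range e = (G.T : Set V)
  antitone : Antitone (G.attrSeq e)

/-- The attractors of the singleton target sets form a chain under inclusion. -/
def AttractorsFormChain (G : OneLargeTargetGame V) : Prop :=
  ∀ t ∈ G.T, ∀ t' ∈ G.T,
    G.singletonAttr t ⊆ G.singletonAttr t' ∨ G.singletonAttr t' ⊆ G.singletonAttr t

/-- The start vertex lies in the smallest attractor `A_k`. -/
def StartInSmallest (G : OneLargeTargetGame V) (e : Fin G.T.card → V) : Prop :=
  G.start ∈ G.attrSeq e (Fin.last G.T.card)

/-- There is `0 ≤ i ≤ k` such that `t_{i+1}` lies in the attractor of `A_i ∩ F₀`. -/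
def SomeTargetReachesF₀ (G : OneLargeTargetGame V) (e : Fin G.T.card → V) : Prop :=
  ∃ i : Fin (G.T.card + 1), G.targetSeq e i ∈ G.arena.attr (G.attrSeq e i ∩ (G.F₀ : Set V))

open Classical in
/-- The standard encoding of a game on the vertex set `{0, …, n - 1}` as a bit string: `n` in
unary, followed by the characteristic vectors of Eve's vertices, of the start vertex, of `F₀`
and of `T`, and by the rows of the adjacency matrix. -/
noncomputable def encode {n : ℕ} (G : OneLargeTargetGame (Fin n)) : List Bool :=
  List.replicate n true ++ [false]
    ++ List.ofFn (fun v => decide (v ∈ G.arena.eve))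
    ++ List.ofFn (fun v => decide (v = G.start))
    ++ List.ofFn (fun v => decide (v ∈ G.F₀))
    ++ List.ofFn (fun v => decide (v ∈ G.T))
    ++ (List.ofFn fun u => List.ofFn fun v => decide (G.arena.Edge u v)).flatten

end OneLargeTargetGame

/-- The decision problem of generalised reachability for games in which all target sets except
one are singletons: the set of the encodings of those games that Eve wins. -/
def oneLargeTargetGenReach : Language Bool :=
  {w | ∃ (n : ℕ) (G : OneLargeTargetGame (Fin n)), G.encode = w ∧ G.EveWins}

open Classical in
/-- The complexity class P: a language belongs to P if some (multi-stack) Turing machine decides,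
for every word `w`, whether `w` belongs to the language, in time polynomial in the length
of `w`. -/
def InP (L : Language Bool) : Prop :=
  Nonempty (Turing.TM2ComputableInPolyTime (id : List Bool → List Bool) Computability.encodeBool
    fun w => decide (w ∈ L))

/-! On a finite arena a win of Eve has finite depth. `Win` expresses it by induction on the number
of moves, for the set of visited vertices and the current vertex; by `GenReachGame.eveWins_iff_win`
it agrees with the existence of a winning strategy.

Since `t ∈ Attr {t'}` is equivalent to `Attr {t} ⊆ Attr {t'}`, both the chain condition and the
condition on the enumeration can be replaced by `Criterion`: any two targets are comparable, the
start lies in all attractors, and some `u`, a target or the start, can force a visit to those `f ∈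
F₀` from which each target can be forced, except targets that can force `u`.

Necessity (`criterion_of_win`). A winning position lies in the attractor of every unvisited target.
Of two targets, the one visited first must therefore force the other (`comparable_of_win`). If no
target serves as `u`, an induction over the winning tree shows that Eve forces a visit to a point of
`F₀` that can still force all targets unvisited at the outset, so the start vertex serves
(`mem_attr_goodTargets_of_win`).

Sufficiency (`eveWins_of_enumeration`). Sort the targets by decreasing size of their attractors. Eve
visits `t_k, t_{k-1}, …, t₁` in this order, which is possible because `t_{i+1} ∈ A_{i+1} ⊆ A_i`. At
`t_{i+1}`, for the index `i` of condition (iii), she makes a detour through `A_i ∩ F₀` and then goes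
on to `t_i`.

An attractor contains every dead end of Adam, although a token stuck there visits nothing new; this
is why part 2 asks Adam's vertices to have successors. For part 1, `withLoops` adds loops at these
dead ends, which does not change the winner.

Membership in P. The criterion is a first-order statement about the edges and two tables of
attractors, each computed by `n` rounds of a first-order update. A stack machine keeps an `n × n`
grid of cells, each holding one bit per table and marks for the rows and columns selected by
finitely many variables. Reading an entry, writing an entry and advancing a variable are single
sweeps over the grid. Hence loops over vertices (`Prog`), and with them formulas, run in polynomial
time (`Prog.runs_compile`, `inP_of_prog`). -/

/-! ### Structured programs on stacks -/

/-- Structured programs that operate on a family of stacks and on an internal state. -/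
inductive StackCode {K : Type} (Γ : K → Type) (σ : Type) : Type
  | push (k : K) (f : σ → Γ k) : StackCode Γ σ
  | pop (k : K) (f : σ → Option (Γ k) → σ) : StackCode Γ σ
  | load (f : σ → σ) : StackCode Γ σ
  | seq (c d : StackCode Γ σ) : StackCode Γ σ
  | loop (b : σ → Bool) (c : StackCode Γ σ) : StackCode Γ σ

namespace StackCode

open Function Turing

variable {K : Type} {Γ : K → Type} {σ : Type}

/-- The labels of the Turing machine program of a structured program. -/
def Label : StackCode Γ σ → Type
  | push _ _ => Unit
  | pop _ _ => Unit
  | load _ => Unit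
  | seq c d => c.Label ⊕ d.Label
  | loop _ c => Option c.Label

theorem finite_label : ∀ c : StackCode Γ σ, Finite c.Label
  | push _ _ => inferInstanceAs (Finite Unit)
  | pop _ _ => inferInstanceAs (Finite Unit)
  | load _ => inferInstanceAs (Finite Unit)
  | seq c d => by
    have := finite_label c
    have := finite_label d
    exact inferInstanceAs (Finite (c.Label ⊕ d.Label))
  | loop _ c => by
    have := finite_label c
    exact inferInstanceAs (Finite (Option c.Label))

/-- The label at which a program starts. -/
def entry : (c : StackCode Γ σ) → c.Label
  | push _ _ => ()
  | pop _ _ => ()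
  | load _ => ()
  | seq c _ => .inl c.entry
  | loop _ _ => none

/-- The Turing machine statements of a program, whose labels are embedded into `Λ` by `emb`, and
which jumps to `exit` when it is done. -/
def stmts {Λ : Type} : (c : StackCode Γ σ) → (c.Label → Λ) → Λ → c.Label → TM2.Stmt Γ Λ σ
  | push k f, _, exit, _ => .push k f (.goto fun _ => exit)
  | pop k f, _, exit, _ => .pop k f (.goto fun _ => exit)
  | load f, _, exit, _ => .load f (.goto fun _ => exit)
  | seq c d, emb, exit, l =>
    Sum.elim (c.stmts (fun l => emb (.inl l)) (emb (.inr d.entry)))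
      (d.stmts (fun l => emb (.inr l)) exit) l
  | loop b c, emb, exit, l =>
    Option.elim l (.branch b (.goto fun _ => emb (some c.entry)) (.goto fun _ => exit))
      (c.stmts (fun l => emb (some l)) (emb none))

variable [DecidableEq K]

/-- `Runs c v S v' S' t` means that the program `c`, started with the state `v` and the stacks
`S`, terminates with `v'` and `S'` after `t` steps. -/
inductive Runs : StackCode Γ σ → σ → (∀ k, List (Γ k)) → σ → (∀ k, List (Γ k)) → ℕ → Prop
  | push (k f v S) : Runs (push k f) v S v (update S k (f v :: S k)) 1
  | pop (k f v S) : Runs (pop k f) v S (f v (S k).head?) (update S k (S k).tail) 1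
  | load (f v S) : Runs (load f) v S (f v) S 1
  | seq {c d v₁ S₁ v₂ S₂ v₃ S₃ t t'} : Runs c v₁ S₁ v₂ S₂ t → Runs d v₂ S₂ v₃ S₃ t' →
      Runs (seq c d) v₁ S₁ v₃ S₃ (t + t')
  | loop_exit {b c v S} : b v = false → Runs (loop b c) v S v S 1
  | loop_iter {b c v₁ S₁ v₂ S₂ v₃ S₃ t t'} : b v₁ = true → Runs c v₁ S₁ v₂ S₂ t →
      Runs (loop b c) v₂ S₂ v₃ S₃ t' → Runs (loop b c) v₁ S₁ v₃ S₃ (1 + t + t')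

/-- A subprogram is a fragment of a larger machine, so the embedding of its labels and its exit must
be arbitrary: in `seq` the first part exits to the entry of the second, in `loop` the body exits to
the test. -/
theorem Runs.iterate_step {c : StackCode Γ σ} {v v' : σ} {S S' : ∀ k, List (Γ k)} {t : ℕ}
    (h : Runs c v S v' S' t) {Λ : Type} (M : Λ → TM2.Stmt Γ Λ σ) (emb : c.Label → Λ) (exit : Λ)
    (hM : ∀ l, M (emb l) = c.stmts emb exit l) :
    (flip bind (TM2.step M))^[t] (some ⟨some (emb c.entry), v, S⟩) =
      some ⟨some exit, v', S'⟩ := by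
  have one (l : Λ) (v : σ) (S : ∀ k, List (Γ k)) :
      (flip bind (TM2.step M))^[1] (some ⟨some l, v, S⟩) = some (TM2.stepAux (M l) v S) := rfl
  induction h generalizing exit with
  | push | pop | load =>
    rw [one, hM]
    rfl
  | seq _ _ ih ih' =>
    rw [Nat.add_comm, iterate_add_apply]
    erw [ih (fun l => emb (.inl l)) (emb (.inr (entry _))) fun l => hM (.inl l)]
    exact ih' (fun l => emb (.inr l)) exit fun l => hM (.inr l)
  | loop_exit hb =>
    rw [one, hM]
    simp only [stmts, entry, Option.elim, TM2.stepAux, hb, cond_false]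
  | loop_iter hb _ _ ih ih' =>
    rw [Nat.add_comm, iterate_add_apply, Nat.add_comm, iterate_add_apply, one, hM]
    simp only [stmts, entry, Option.elim, TM2.stepAux, hb, cond_true]
    erw [ih (fun l => emb (some l)) (emb none) fun l => hM (some l)]
    exact ih' emb exit hM

/-- The Turing machine that executes a program and halts. The stack `k` is used both for the input
and for the output. -/
noncomputable def machine [Fintype K] [Finite σ] (k : K) [Fintype (Γ k)] (v : σ)
    (c : StackCode Γ σ) : FinTM2 :=
  { K := K
    k₀ := k
    k₁ := k
    Γ := Γ
    Λ := Option c.Label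
    main := some c.entry
    ΛFin := @Fintype.ofFinite _ (have := c.finite_label; inferInstance)
    σ := σ
    initialState := v
    σFin := Fintype.ofFinite σ
    m := fun l => Option.elim l .halt (c.stmts some none) }

theorem Runs.machine_outputs [Fintype K] [Finite σ] {k : K} [Fintype (Γ k)] {v : σ}
    {c : StackCode Γ σ} {x y : List (Γ k)} {t : ℕ}
    (h : Runs c v (update (fun _ => []) k x) v (update (fun _ => []) k y) t) :
    Nonempty (TM2OutputsInTime (machine k v c) x (some y) (t + 1)) := by
  have hstk : ∀ (z : List (Γ k)), (fun k' =>
      @dite (List (Γ k')) (k' = k) (inferInstance) (fun h => by rw [h]; exact z) fun _ => []) =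
      update (fun _ => []) k z := by
    intro z
    funext k'
    by_cases hk : k' = k
    · subst hk; simp
    · simp [hk]
  -- The additional step executes `halt` at the exit label.
  refine ⟨⟨⟨t + 1, ?_⟩, le_rfl⟩⟩
  have := h.iterate_step (machine k v c).m some none fun l => rfl
  rw [Nat.add_comm, iterate_add_apply]
  unfold initList haltList
  erw [hstk x]
  erw [this]
  simp only [Option.map]
  erw [hstk y]
  rfl

end StackCode

/-! ### Attractors -/

namespace GameArena

variable {V : Type*} (A : GameArena V)

theorem attrStep_mono_nat (S : Set V) : Monotone (A.attrStep S) :=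
  monotone_nat_of_le_succ fun _ _ h => .inl (.inl h)

theorem subset_attr (S : Set V) : S ⊆ A.attr S := fun _ h => Set.mem_iUnion.2 ⟨0, h⟩

theorem attrStep_subset_attr (S : Set V) (i : ℕ) : A.attrStep S i ⊆ A.attr S :=
  Set.subset_iUnion (A.attrStep S) i

theorem mem_attr_of_eve {S : Set V} {u v : V} (hu : u ∈ A.eve) (hv : v ∈ A.succ u)
    (h : v ∈ A.attr S) : u ∈ A.attr S := by
  obtain ⟨i, hi⟩ := Set.mem_iUnion.1 h
  exact A.attrStep_subset_attr S (i + 1) (.inl (.inr ⟨hu, v, hv, hi⟩))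

/-- Finiteness gives a common bound for the stages at which the successors join. -/
theorem mem_attr_of_adam [Finite V] {S : Set V} {u : V} (hu : u ∈ A.adam)
    (h : ∀ v ∈ A.succ u, v ∈ A.attr S) : u ∈ A.attr S := by
  have : ∀ v, ∃ i, v ∈ A.succ u → v ∈ A.attrStep S i := fun v => by
    by_cases hv : v ∈ A.succ u
    · obtain ⟨i, hi⟩ := Set.mem_iUnion.1 (h v hv)
      exact ⟨i, fun _ => hi⟩
    · exact ⟨0, fun h => absurd h hv⟩
  choose f hf using this
  obtain ⟨m, hm⟩ := (Set.finite_range f).bddAbove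
  exact A.attrStep_subset_attr S (m + 1)
    (.inr ⟨hu, fun v hv => A.attrStep_mono_nat S (hm ⟨v, rfl⟩) (hf v hv)⟩)

theorem attr_induction {S : Set V} {P : V → Prop} (h0 : ∀ u ∈ S, P u)
    (he : ∀ u ∈ A.eve, ∀ v ∈ A.succ u, P v → P u)
    (ha : ∀ u ∈ A.adam, (∀ v ∈ A.succ u, P v) → P u) {u : V} (hu : u ∈ A.attr S) : P u := by
  obtain ⟨i, hi⟩ := Set.mem_iUnion.1 hu
  induction i generalizing u with
  | zero => exact h0 u hi
  | succ i ih =>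
    obtain (hi | ⟨hu', v, hv, hi⟩) | ⟨hu', hi⟩ := hi
    · exact ih (A.attrStep_subset_attr S i hi) hi
    · exact he u hu' v hv (ih (A.attrStep_subset_attr S i hi) hi)
    · exact ha u hu' fun v hv => ih (A.attrStep_subset_attr S i (hi v hv)) (hi v hv)

theorem attr_subset [Finite V] {S S' : Set V} (h : S ⊆ A.attr S') : A.attr S ⊆ A.attr S' :=
  fun _ => A.attr_induction (fun _ hu => h hu) (fun _ hu _ hv h => A.mem_attr_of_eve hu hv h)
    fun _ hu h => A.mem_attr_of_adam hu h

theorem attr_mono [Finite V] {S S' : Set V} (h : S ⊆ S') : A.attr S ⊆ A.attr S' :=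
  A.attr_subset (h.trans (A.subset_attr S'))

theorem attr_singleton_subset_iff [Finite V] {t : V} {S : Set V} :
    A.attr {t} ⊆ A.attr S ↔ t ∈ A.attr S :=
  ⟨fun h => h (A.subset_attr _ rfl), fun h => A.attr_subset (by simpa using h)⟩

theorem mem_attr_self (t : V) : t ∈ A.attr {t} := A.subset_attr _ rfl

/-- In an arena with `n` vertices, the attractor is reached after `n` steps. -/
theorem attr_eq_attrStep [Finite V] (S : Set V) : A.attr S = A.attrStep S (Nat.card V) := by
  -- A stage that adds nothing is closed under both rules and hence final; until then every stage
  -- gains a vertex.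
  have key : ∀ i, A.attrStep S i = A.attr S ∨ i ≤ (A.attrStep S i).ncard := by
    intro i
    induction i with
    | zero => exact .inr (Nat.zero_le _)
    | succ i ih =>
      by_cases hi : A.attrStep S (i + 1) = A.attrStep S i
      · left
        refine (A.attrStep_subset_attr S _).antisymm fun u hu => ?_
        rw [hi]
        refine A.attr_induction (fun u hu => A.attrStep_mono_nat S (Nat.zero_le i) hu)
          (fun u hu v hv h => ?_) (fun u hu h => ?_) hu
        · rw [← hi]
          exact .inl (.inr ⟨hu, v, hv, h⟩)
        · rw [← hi]
          exact .inr ⟨hu, h⟩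
      · have hss : A.attrStep S i ⊂ A.attrStep S (i + 1) :=
          (A.attrStep_mono_nat S i.le_succ).lt_of_ne (Ne.symm hi)
        rcases ih with ih | ih
        · exact absurd (hss.2 (ih ▸ A.attrStep_subset_attr S (i + 1))) id
        · exact .inr (ih.trans_lt (Set.ncard_lt_ncard hss (Set.toFinite _)))
  rcases key (Nat.card V) with h | h
  · exact h.symm
  · have : A.attrStep S (Nat.card V) = Set.univ :=
      Set.eq_of_subset_of_ncard_le (Set.subset_univ _) (by rwa [Set.ncard_univ]) (Set.toFinite _)
    rw [this]
    exact Set.eq_univ_of_univ_subset (this ▸ A.attrStep_subset_attr S _)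

/-! ### Winning positions with memory -/

/-- Eve can force, within `n` moves from `v`, that the set of visited vertices meets every target
set, when the vertices in `vis` have been visited already. -/
def winStep (𝓕 : Finset (Finset V)) : ℕ → Set V → V → Prop
  | 0, vis, _ => ∀ F ∈ 𝓕, ∃ x ∈ vis, x ∈ F
  | n + 1, vis, v => winStep 𝓕 n vis v
      ∨ (v ∈ A.eve ∧ ∃ u ∈ A.succ v, winStep 𝓕 n (insert u vis) u)
      ∨ (v ∈ A.adam ∧ (A.succ v).Nonempty ∧ ∀ u ∈ A.succ v, winStep 𝓕 n (insert u vis) u)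

/-- Eve can force that the set of visited vertices meets every target set. -/
def Win (𝓕 : Finset (Finset V)) (vis : Set V) (v : V) : Prop := ∃ n, A.winStep 𝓕 n vis v

variable {A} {𝓕 : Finset (Finset V)} {vis : Set V} {v : V}

theorem winStep_mono_nat (𝓕 : Finset (Finset V)) (vis : Set V) (v : V) :
    Monotone fun n => A.winStep 𝓕 n vis v :=
  monotone_nat_of_le_succ fun _ h => .inl h

theorem Win.done (h : ∀ F ∈ 𝓕, ∃ x ∈ vis, x ∈ F) : A.Win 𝓕 vis v := ⟨0, h⟩

theorem Win.of_eve (hv : v ∈ A.eve) {u : V} (hu : u ∈ A.succ v)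
    (h : A.Win 𝓕 (insert u vis) u) : A.Win 𝓕 vis v := by
  obtain ⟨n, hn⟩ := h
  exact ⟨n + 1, .inr (.inl ⟨hv, u, hu, hn⟩)⟩

theorem Win.of_adam [Finite V] (hv : v ∈ A.adam) (hs : (A.succ v).Nonempty)
    (h : ∀ u ∈ A.succ v, A.Win 𝓕 (insert u vis) u) : A.Win 𝓕 vis v := by
  have : ∀ u, ∃ i, u ∈ A.succ v → A.winStep 𝓕 i (insert u vis) u := fun u => by
    by_cases hu : u ∈ A.succ v
    · obtain ⟨i, hi⟩ := h u hu
      exact ⟨i, fun _ => hi⟩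
    · exact ⟨0, fun h => absurd h hu⟩
  choose f hf using this
  obtain ⟨m, hm⟩ := (Set.finite_range f).bddAbove
  exact ⟨m + 1, .inr (.inr ⟨hv, hs, fun u hu =>
    winStep_mono_nat 𝓕 _ u (hm ⟨u, rfl⟩) (hf u hu)⟩)⟩

theorem Win.induction {P : Set V → V → Prop}
    (h0 : ∀ vis v, (∀ F ∈ 𝓕, ∃ x ∈ vis, x ∈ F) → P vis v)
    (he : ∀ vis, ∀ v ∈ A.eve, ∀ u ∈ A.succ v, A.Win 𝓕 (insert u vis) u → P (insert u vis) u →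
      P vis v)
    (ha : ∀ vis, ∀ v ∈ A.adam, (A.succ v).Nonempty →
      (∀ u ∈ A.succ v, A.Win 𝓕 (insert u vis) u) → (∀ u ∈ A.succ v, P (insert u vis) u) →
      P vis v) (h : A.Win 𝓕 vis v) : P vis v := by
  obtain ⟨n, hn⟩ := h
  induction n generalizing vis v with
  | zero => exact h0 vis v hn
  | succ n ih =>
    obtain hn | ⟨hv, u, hu, hn⟩ | ⟨hv, hs, hn⟩ := hn
    · exact ih hn
    · exact he vis v hv u hu ⟨n, hn⟩ (ih hn)
    · exact ha vis v hv hs (fun u hu => ⟨n, hn u hu⟩) fun u hu => ih (hn u hu)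

theorem Win.mono [Finite V] {vis' : Set V} (h : A.Win 𝓕 vis v) (hvis : vis ⊆ vis') :
    A.Win 𝓕 vis' v := by
  refine Win.induction (P := fun vis v => ∀ vis', vis ⊆ vis' → A.Win 𝓕 vis' v) ?_ ?_ ?_ h vis' hvis
  · intro vis v h vis' hvis
    refine .done fun F hF => ?_
    obtain ⟨x, hx, hxF⟩ := h F hF
    exact ⟨x, hvis hx, hxF⟩
  · intro vis v hv u hu _ ih vis' hvis
    exact .of_eve hv hu (ih _ (Set.insert_subset_insert hvis))
  · intro vis v hv hs _ ih vis' hvis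
    exact .of_adam hv hs fun u hu => ih u hu _ (Set.insert_subset_insert hvis)

/-- Eve can first force a visit to `S` and then continue to win. -/
theorem Win.of_mem_attr [Finite V] (hA : ∀ v ∈ A.adam, (A.succ v).Nonempty) {S : Set V}
    (hS : ∀ u ∈ S, A.Win 𝓕 (insert u vis) u) (hv : v ∈ A.attr S) (hvis : v ∈ vis) :
    A.Win 𝓕 vis v := by
  refine A.attr_induction (P := fun v => ∀ vis' : Set V, vis ⊆ vis' → v ∈ vis' → A.Win 𝓕 vis' v)
    ?_ ?_ ?_ hv vis subset_rfl hvis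
  · intro u hu vis' hsub hmem
    exact (hS u hu).mono (Set.insert_subset hmem hsub)
  · intro u hu w hw ih vis' hsub hmem
    exact .of_eve hu hw (ih _ (hsub.trans (Set.subset_insert _ _)) (Set.mem_insert _ _))
  · intro u hu ih vis' hsub hmem
    exact .of_adam hu (hA u hu) fun w hw =>
      ih w hw _ (hsub.trans (Set.subset_insert _ _)) (Set.mem_insert _ _)

/-! ### Winning positions and strategies -/

/-- The vertices that are visited during the first `n` moves. -/
def visited (σ : A.Strategy A.eve) (τ : A.Strategy A.adam) (s : V) (n : ℕ) : Set V :=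
  {x | x ∈ (A.position σ τ s n).1 ++ [(A.position σ τ s n).2]}

theorem visited_succ (σ : A.Strategy A.eve) (τ : A.Strategy A.adam) (s : V) (n : ℕ) :
    visited σ τ s (n + 1) = insert (A.play σ τ s (n + 1)) (visited σ τ s n) := by
  ext x
  simp only [visited, play, position, Set.mem_ofPred_eq, Set.mem_insert_iff, List.mem_append,
    List.mem_singleton]
  tauto

theorem visited_zero (σ : A.Strategy A.eve) (τ : A.Strategy A.adam) (s : V) :
    visited σ τ s 0 = {s} := by
  ext x
  simp [visited, position]

theorem mem_visited_iff (σ : A.Strategy A.eve) (τ : A.Strategy A.adam) (s : V) (n : ℕ) (x : V) :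
    x ∈ visited σ τ s n ↔ ∃ j ≤ n, A.play σ τ s j = x := by
  induction n with
  | zero => simp [visited_zero, play, position, eq_comm]
  | succ n ih =>
    rw [visited_succ, Set.mem_insert_iff, ih]
    constructor
    · rintro (rfl | ⟨j, hj, rfl⟩)
      · exact ⟨_, le_rfl, rfl⟩
      · exact ⟨j, hj.trans n.le_succ, rfl⟩
    · rintro ⟨j, hj, rfl⟩
      rcases hj.eq_or_lt with rfl | hj
      · exact .inl rfl
      · exact .inr ⟨j, Nat.lt_succ_iff.1 hj, rfl⟩

/-- Targets are met if the set of visited vertices meets them. -/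
theorem exists_play_mem_iff (σ : A.Strategy A.eve) (τ : A.Strategy A.adam) (s : V) (n : ℕ) :
    (∀ F ∈ 𝓕, ∃ j ≤ n, A.play σ τ s j ∈ F) ↔ ∀ F ∈ 𝓕, ∃ x ∈ visited σ τ s n, x ∈ F := by
  refine forall₂_congr fun F _ => ⟨?_, ?_⟩
  · rintro ⟨j, hj, h⟩
    exact ⟨_, (mem_visited_iff ..).2 ⟨j, hj, rfl⟩, h⟩
  · rintro ⟨x, hx, h⟩
    obtain ⟨j, hj, rfl⟩ := (mem_visited_iff ..).1 hx
    exact ⟨j, hj, h⟩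

theorem play_succ (σ : A.Strategy A.eve) (τ : A.Strategy A.adam) (s : V) (n : ℕ) :
    A.play σ τ s (n + 1) =
      A.nextVertex σ τ (A.position σ τ s n).1 (A.play σ τ s n) := rfl

open Classical in
/-- Eve's strategy that moves to a vertex from which the fewest moves are needed to win. -/
noncomputable def eveStrategy (A : GameArena V) (𝓕 : Finset (Finset V)) : A.Strategy A.eve where
  move h v :=
    if hs : ∃ n, ∃ u ∈ A.succ v, A.winStep 𝓕 n (insert u {x | x ∈ h ++ [v]}) u then
      (Nat.find_spec hs).choose
    else if hs : (A.succ v).Nonempty then hs.choose else v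
  move_mem h v _ hs := by
    split_ifs with h'
    · exact (Nat.find_spec h').choose_spec.1
    · exact hs.choose_spec

/-- The strategy minimises the number of remaining moves over all successors, so any bound attained
by some successor holds for the chosen one. -/
theorem winStep_eveStrategy {n : ℕ} {h : List V} {v u : V} (hu : u ∈ A.succ v)
    (hn : A.winStep 𝓕 n (insert u {x | x ∈ h ++ [v]}) u) :
    A.winStep 𝓕 n (insert ((A.eveStrategy 𝓕).move h v) {x | x ∈ h ++ [v]})
      ((A.eveStrategy 𝓕).move h v) := by
  classical
  have hs : ∃ n, ∃ u ∈ A.succ v, A.winStep 𝓕 n (insert u {x | x ∈ h ++ [v]}) u := ⟨n, u, hu, hn⟩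
  simp only [eveStrategy, hs, dif_pos]
  exact winStep_mono_nat 𝓕 _ _ (Nat.find_min' hs ⟨u, hu, hn⟩) (Nat.find_spec hs).choose_spec.2

open Classical in
/-- Adam's strategy that moves to a vertex from which Eve cannot win, if possible. -/
noncomputable def adamStrategy (A : GameArena V) (𝓕 : Finset (Finset V)) : A.Strategy A.adam where
  move h v :=
    if hs : ∃ u ∈ A.succ v, ¬ A.Win 𝓕 (insert u {x | x ∈ h ++ [v]}) u then hs.choose
    else if hs : (A.succ v).Nonempty then hs.choose else v
  move_mem h v _ hs := by
    split_ifs with h'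
    · exact h'.choose_spec.1
    · exact hs.choose_spec

theorem not_win_adamStrategy {h : List V} {v u : V} (hu : u ∈ A.succ v)
    (hn : ¬ A.Win 𝓕 (insert u {x | x ∈ h ++ [v]}) u) :
    ¬ A.Win 𝓕 (insert ((A.adamStrategy 𝓕).move h v) {x | x ∈ h ++ [v]})
      ((A.adamStrategy 𝓕).move h v) := by
  have hs : ∃ u ∈ A.succ v, ¬ A.Win 𝓕 (insert u {x | x ∈ h ++ [v]}) u := ⟨u, hu, hn⟩
  simp only [adamStrategy, hs, dif_pos]
  exact hs.choose_spec.2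

theorem exists_visited_of_winStep (τ : A.Strategy A.adam) (s : V) (n k : ℕ)
    (h : A.winStep 𝓕 n (visited (A.eveStrategy 𝓕) τ s k) (A.play (A.eveStrategy 𝓕) τ s k)) :
    ∃ m, ∀ F ∈ 𝓕, ∃ x ∈ visited (A.eveStrategy 𝓕) τ s m, x ∈ F := by
  induction n generalizing k with
  | zero => exact ⟨k, h⟩
  | succ n ih =>
    obtain hn | ⟨hv, u, hu, hn⟩ | ⟨hv, hs, hn⟩ := h
    · exact ih k hn
    · refine ih (k + 1) ?_
      have hs : (A.succ (A.play (A.eveStrategy 𝓕) τ s k)).Nonempty := ⟨u, hu⟩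
      have := winStep_eveStrategy hu hn
      rw [visited_succ, play_succ, nextVertex, if_pos hs, if_pos hv]
      exact this
    · refine ih (k + 1) ?_
      rw [visited_succ, play_succ, nextVertex, if_pos hs, if_neg hv]
      exact hn _ (τ.move_mem _ _ hv hs)

/-- Not being won is an invariant: no move of Eve ends it, Adam's strategy preserves it, and at a
dead end neither the vertex nor the visited set changes. -/
theorem not_win_visited [Finite V] (σ : A.Strategy A.eve) (s : V) (h : ¬ A.Win 𝓕 {s} s) (k : ℕ) :
    ¬ A.Win 𝓕 (visited σ (A.adamStrategy 𝓕) s k) (A.play σ (A.adamStrategy 𝓕) s k) := by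
  induction k with
  | zero => simpa [visited_zero, play, position] using h
  | succ k ih =>
    by_cases hs : (A.succ (A.play σ (A.adamStrategy 𝓕) s k)).Nonempty
    · by_cases hv : A.play σ (A.adamStrategy 𝓕) s k ∈ A.eve
      · rw [visited_succ, play_succ, nextVertex, if_pos hs, if_pos hv]
        exact fun hw => ih (.of_eve hv (σ.move_mem _ _ hv hs) hw)
      · obtain ⟨u, hu, hw⟩ : ∃ u ∈ A.succ (A.play σ (A.adamStrategy 𝓕) s k),
            ¬ A.Win 𝓕 (insert u (visited σ (A.adamStrategy 𝓕) s k)) u := by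
          by_contra! hcon
          exact ih (.of_adam hv hs hcon)
        rw [visited_succ, play_succ, nextVertex, if_pos hs, if_neg hv]
        exact not_win_adamStrategy hu hw
    · have hnext : A.play σ (A.adamStrategy 𝓕) s (k + 1) = A.play σ (A.adamStrategy 𝓕) s k := by
        rw [play_succ, nextVertex, if_neg hs]
      rw [visited_succ, hnext, Set.insert_eq_of_mem]
      · exact ih
      · exact (mem_visited_iff ..).2 ⟨k, le_rfl, rfl⟩

end GameArena

open GameArena in
theorem GenReachGame.eveWins_iff_win {V : Type*} [Finite V] (G : GenReachGame V) :
    G.EveWins ↔ G.arena.Win G.targets {G.start} G.start := by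
  constructor
  · rintro ⟨σ, hσ⟩
    by_contra h
    obtain ⟨k, hk⟩ := hσ (G.arena.adamStrategy G.targets)
    exact not_win_visited σ G.start h k (.done ((exists_play_mem_iff ..).1 hk))
  · rintro ⟨n, hn⟩
    refine ⟨G.arena.eveStrategy G.targets, fun τ => ?_⟩
    obtain ⟨k, hk⟩ := exists_visited_of_winStep τ G.start n 0
      (by simpa [visited_zero, play, position] using hn)
    exact ⟨k, (exists_play_mem_iff ..).2 hk⟩

/-! ### Necessity of the criterion -/

namespace GameArena

variable {V : Type*} [Finite V] {A : GameArena V} {𝓕 : Finset (Finset V)} {vis : Set V} {v : V}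

/-- If Eve wins, then she can force a visit to each target set that has not been visited yet. -/
theorem Win.mem_attr (h : A.Win 𝓕 vis v) {F : Finset V} (hF : F ∈ 𝓕) (hvis : ∀ x ∈ vis, x ∉ F) :
    v ∈ A.attr (F : Set V) := by
  revert hvis
  refine Win.induction (P := fun vis v => (∀ x ∈ vis, x ∉ F) → v ∈ A.attr (F : Set V))
    ?_ ?_ ?_ h
  · intro vis v hd hvis
    obtain ⟨x, hx, hxF⟩ := hd F hF
    exact absurd hxF (hvis x hx)
  · intro vis v hv u hu _ ih hvis
    refine A.mem_attr_of_eve hv hu ?_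
    by_cases huF : u ∈ F
    · exact A.subset_attr _ huF
    · exact ih fun x hx => hx.elim (fun h => h ▸ huF) (hvis x)
  · intro vis v hv _ _ ih hvis
    refine A.mem_attr_of_adam hv fun u hu => ?_
    by_cases huF : u ∈ F
    · exact A.subset_attr _ huF
    · exact ih u hu fun x hx => hx.elim (fun h => h ▸ huF) (hvis x)

end GameArena

namespace OneLargeTargetGame

open GameArena

variable {V : Type*} (G : OneLargeTargetGame V)

/-- The elements of `F₀` from which Eve can force a visit to each target `t` from which she cannot
force a visit to `u`. -/
def usefulTargets (u : V) : Set V :=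
  {f | f ∈ G.F₀ ∧ ∀ t ∈ G.T, t ∈ G.singletonAttr u ∨ f ∈ G.singletonAttr t}

/-- A criterion for Eve to win that does not refer to an enumeration of the targets. -/
structure Criterion : Prop where
  comparable : ∀ t ∈ G.T, ∀ t' ∈ G.T, t ∈ G.singletonAttr t' ∨ t' ∈ G.singletonAttr t
  start_mem : ∀ t ∈ G.T, G.start ∈ G.singletonAttr t
  reach : ∃ u, (u ∈ G.T ∨ u = G.start) ∧ u ∈ G.arena.attr (G.usefulTargets u)

variable {G}

theorem forall_targets_iff {vis : Set V} :
    (∀ F ∈ G.toGenReachGame.targets, ∃ x ∈ vis, x ∈ F) ↔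
      (∃ x ∈ vis, x ∈ G.F₀) ∧ ∀ t ∈ G.T, t ∈ vis := by
  classical
  simp [toGenReachGame]

theorem Criterion.startInSmallest (h : G.Criterion) {e : Fin G.T.card → V}
    (he : G.IsDescendingEnumeration e) : G.StartInSmallest e := by
  have key : ∀ j : Fin (G.T.card + 1), G.start ∈ G.attrSeq e j := by
    intro j
    cases j using Fin.cases with
    | zero => exact Set.mem_univ _
    | succ i => exact h.start_mem _ (he.range_eq ▸ ⟨i, rfl⟩ : e i ∈ (G.T : Set V))
  exact key _

variable [Finite V]

theorem mem_singletonAttr_of_win {vis : Set V} {v : V}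
    (h : G.arena.Win G.toGenReachGame.targets vis v) {t : V} (ht : t ∈ G.T) (hvis : t ∉ vis) :
    v ∈ G.singletonAttr t := by
  classical
  have := h.mem_attr (F := {t}) (by simp [toGenReachGame, ht]) fun x hx => by
    rw [Finset.mem_singleton]
    rintro rfl
    exact hvis hx
  simpa [singletonAttr] using this

/-- If neither target could force the other, neither could ever be visited: on reaching one, Eve
would still have to force the other. Both would stay unvisited down to the leaves of the winning
tree. -/
theorem comparable_of_win {vis : Set V} {v : V}
    (h : G.arena.Win G.toGenReachGame.targets vis v) {t t' : V} (ht : t ∈ G.T) (ht' : t' ∈ G.T)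
    (hvis : t ∉ vis) (hvis' : t' ∉ vis) :
    t ∈ G.singletonAttr t' ∨ t' ∈ G.singletonAttr t := by
  by_contra! hcon
  obtain ⟨h1, h2⟩ := hcon
  have key : ∀ (u : V) (vis : Set V), G.arena.Win G.toGenReachGame.targets (insert u vis) u →
      t ∉ vis → t' ∉ vis → t ∉ insert u vis ∧ t' ∉ insert u vis := by
    intro u vis hw hvis hvis'
    have htt : t ≠ t' := by
      rintro rfl
      exact h1 (mem_attr_self _ _)
    constructor
    · rintro (rfl | hmem)
      · exact h1 (mem_singletonAttr_of_win hw ht' (by simp [htt.symm, hvis']))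
      · exact hvis hmem
    · rintro (rfl | hmem)
      · exact h2 (mem_singletonAttr_of_win hw ht (by simp [htt, hvis]))
      · exact hvis' hmem
  revert hvis hvis'
  refine Win.induction (P := fun vis _ => t ∉ vis → t' ∉ vis → False) ?_ ?_ ?_ h
  · intro vis v hd hvis _
    exact hvis ((forall_targets_iff.1 hd).2 t ht)
  · intro vis v _ u _ hw ih hvis hvis'
    exact ih (key u vis hw hvis hvis').1 (key u vis hw hvis hvis').2
  · intro vis v _ ⟨u, hu⟩ hw ih hvis hvis'
    exact ih u hu (key u vis (hw u hu) hvis hvis').1 (key u vis (hw u hu) hvis hvis').2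

/-- The elements of `F₀` from which Eve can force a visit to each target that has not been
visited. -/
def goodTargets (G : OneLargeTargetGame V) (vis : Set V) : Set V :=
  {f | f ∈ G.F₀ ∧ ∀ t ∈ G.T, t ∉ vis → f ∈ G.singletonAttr t}

/-- Induction over the winning tree up to the first visit to `F₀`. The invariant `hT`, that visited
targets can force the unvisited ones, survives because every winning vertex can force what is
unvisited. -/
theorem mem_attr_goodTargets_of_win
    (hG : ∀ u ∈ G.T, u ∉ G.arena.attr (G.usefulTargets u)) {vis : Set V} {v : V}
    (h : G.arena.Win G.toGenReachGame.targets vis v) (hF : ∀ x ∈ vis, x ∉ G.F₀)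
    (hT : ∀ t ∈ G.T, t ∈ vis → ∀ t' ∈ G.T, t' ∉ vis → t ∈ G.singletonAttr t') :
    v ∈ G.arena.attr (G.goodTargets vis) := by
  have key : ∀ (u : V) (vis : Set V), G.arena.Win G.toGenReachGame.targets (insert u vis) u →
      (∀ x ∈ vis, x ∉ G.F₀) →
      (∀ t ∈ G.T, t ∈ vis → ∀ t' ∈ G.T, t' ∉ vis → t ∈ G.singletonAttr t') →
      ((∀ x ∈ insert u vis, x ∉ G.F₀) →
      (∀ t ∈ G.T, t ∈ insert u vis → ∀ t' ∈ G.T, t' ∉ insert u vis → t ∈ G.singletonAttr t') →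
      u ∈ G.arena.attr (G.goodTargets (insert u vis))) →
      u ∈ G.arena.attr (G.goodTargets vis) := by
    intro u vis hw hF hT ih
    have hu : ∀ t ∈ G.T, t ∉ vis → u ∈ G.singletonAttr t := by
      intro t ht htv
      by_cases htu : t = u
      · subst htu; exact mem_attr_self _ _
      · exact mem_singletonAttr_of_win hw ht (by simp [htu, htv])
    -- By `hu`, a point of `F₀` reached here is itself good.
    by_cases huF : u ∈ G.F₀
    · exact G.arena.subset_attr _ ⟨huF, hu⟩
    · have := ih (fun x hx => hx.elim (fun h => h ▸ huF) (hF x)) fun t ht htv t' ht' htv' => by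
        rcases htv with rfl | htv
        · exact hu t' ht' fun h => htv' (.inr h)
        · exact hT t ht htv t' ht' fun h => htv' (.inr h)
      -- At a newly visited target `u`, all targets visited before can force `u`, so the good
      -- targets are useful for `u`, contrary to `hG`. Any other `u` leaves the set of unvisited
      -- targets unchanged.
      by_cases hcase : u ∈ G.T ∧ u ∉ vis
      · refine absurd (G.arena.attr_mono ?_ this) (hG u hcase.1)
        rintro f ⟨hf, hfT⟩
        refine ⟨hf, fun t ht => ?_⟩
        by_cases htv : t ∈ insert u vis
        · left
          rcases htv with rfl | htv
          · exact mem_attr_self _ _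
          · exact hT t ht htv u hcase.1 hcase.2
        · exact .inr (hfT t ht htv)
      · refine G.arena.attr_mono ?_ this
        rintro f ⟨hf, hfT⟩
        refine ⟨hf, fun t ht htv => hfT t ht ?_⟩
        rintro (rfl | h)
        · exact hcase ⟨ht, htv⟩
        · exact htv h
  revert hF hT
  refine Win.induction (P := fun vis v => (∀ x ∈ vis, x ∉ G.F₀) →
    (∀ t ∈ G.T, t ∈ vis → ∀ t' ∈ G.T, t' ∉ vis → t ∈ G.singletonAttr t') →
    v ∈ G.arena.attr (G.goodTargets vis)) ?_ ?_ ?_ h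
  · intro vis v hd hF _
    obtain ⟨x, hx, hxF⟩ := (forall_targets_iff.1 hd).1
    exact absurd hxF (hF x hx)
  · intro vis v hv u hu hw ih hF hT
    exact G.arena.mem_attr_of_eve hv hu (key u vis hw hF hT ih)
  · intro vis v hv _ hw ih hF hT
    exact G.arena.mem_attr_of_adam hv fun u hu => key u vis (hw u hu) hF hT (ih u hu)

theorem criterion_of_win (h : G.arena.Win G.toGenReachGame.targets {G.start} G.start) :
    G.Criterion := by
  have hs : ∀ t ∈ G.T, G.start ∈ G.singletonAttr t := by
    intro t ht
    by_cases hts : t = G.start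
    · subst hts; exact mem_attr_self _ _
    · exact mem_singletonAttr_of_win h ht hts
  refine ⟨fun t ht t' ht' => ?_, hs, ?_⟩
  · by_cases hts : t = G.start
    · exact .inl (hts ▸ hs t' ht')
    by_cases hts' : t' = G.start
    · exact .inr (hts' ▸ hs t ht)
    exact comparable_of_win h ht ht' hts hts'
  · by_contra! hcon
    -- When no target serves as the required `u`, the start vertex does.
    refine hcon G.start (.inr rfl) ?_
    by_cases hsF : G.start ∈ G.F₀
    · exact G.arena.subset_attr _ ⟨hsF, fun t ht => .inr (hs t ht)⟩
    · refine G.arena.attr_mono ?_ (mem_attr_goodTargets_of_win (fun u hu => hcon u (.inl hu)) h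
        (by simpa using hsF) fun t _ hts t' ht' _ => by
          rw [Set.mem_singleton_iff.1 hts]
          exact hs t' ht')
      rintro f ⟨hf, hfT⟩
      refine ⟨hf, fun t ht => ?_⟩
      by_cases hts : t = G.start
      · exact .inl (hts ▸ mem_attr_self _ _)
      · exact .inr (hfT t ht hts)

/-! ### Sufficiency: ordering the targets and winning along the order -/

theorem Criterion.attractorsFormChain (h : G.Criterion) : G.AttractorsFormChain :=
  fun t ht t' ht' => (h.comparable t ht t' ht').imp (attr_singleton_subset_iff _).2
    (attr_singleton_subset_iff _).2

/-- Take the first target in the enumeration that can force `u`. It can then force the useful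
targets of `u`, and these lie in the attractor of its predecessor, which cannot force `u`. If no
target can force `u`, then `u` is the start vertex and the last index works. -/
theorem Criterion.someTargetReachesF₀ (h : G.Criterion) {e : Fin G.T.card → V}
    (he : G.IsDescendingEnumeration e) : G.SomeTargetReachesF₀ e := by
  obtain ⟨u, hu, hattr⟩ := h.reach
  have hmem : ∀ i, e i ∈ G.T := fun i => (he.range_eq ▸ ⟨i, rfl⟩ : e i ∈ (G.T : Set V))
  have key : ∀ j : Fin (G.T.card + 1), (∀ i : Fin G.T.card, i.castSucc < j →
      e i ∉ G.singletonAttr u) → G.usefulTargets u ⊆ G.attrSeq e j ∩ (G.F₀ : Set V) := by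
    rintro j hj f ⟨hf, hfT⟩
    refine ⟨?_, hf⟩
    cases j using Fin.cases with
    | zero => exact Set.mem_univ _
    | succ i => exact (hfT _ (hmem i)).resolve_left (hj i Fin.castSucc_lt_succ)
  by_cases hex : ∃ i, e i ∈ G.singletonAttr u
  · classical
    obtain ⟨i, hi, hmin⟩ : ∃ i, e i ∈ G.singletonAttr u ∧
        ∀ i' < i, e i' ∉ G.singletonAttr u := by
      obtain ⟨i, hi, hmin⟩ := WellFounded.has_min (wellFounded_lt (α := Fin G.T.card))
        {i | e i ∈ G.singletonAttr u} hex
      exact ⟨i, hi, fun i' hi' h' => hmin i' h' hi'⟩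
    refine ⟨i.castSucc, ?_⟩
    rw [targetSeq, Fin.snoc_castSucc]
    refine G.arena.attr_mono (key i.castSucc fun i' hi' => hmin i' ?_) ?_
    · simpa using hi'
    · exact G.arena.attr_subset (by simpa using hattr) hi
  · have hus : u = G.start := by
      refine hu.resolve_left fun huT => hex ?_
      obtain ⟨i, rfl⟩ : u ∈ Set.range e := he.range_eq ▸ huT
      exact ⟨i, mem_attr_self _ _⟩
    refine ⟨Fin.last _, ?_⟩
    rw [targetSeq, Fin.snoc_last, ← hus]
    exact G.arena.attr_mono (key _ fun i _ hi => hex ⟨i, hi⟩) hattr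

/-- Sorting by decreasing cardinality suffices: in a chain of finite sets, a set that is not larger
is contained in the other. -/
theorem exists_isDescendingEnumeration (h : G.AttractorsFormChain) :
    ∃ e : Fin G.T.card → V, G.IsDescendingEnumeration e := by
  let e₀ : Fin G.T.card ≃ G.T := G.T.equivFin.symm
  let f : Fin G.T.card → ℕᵒᵈ := fun i => OrderDual.toDual (G.singletonAttr (e₀ i)).ncard
  refine ⟨fun i => e₀ (Tuple.sort f i), ?_, ?_, ?_⟩
  · exact Subtype.val_injective.comp (e₀.injective.comp (Tuple.sort f).injective)
  · ext x
    constructor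
    · rintro ⟨i, rfl⟩
      exact (e₀ (Tuple.sort f i)).2
    · intro hx
      exact ⟨(Tuple.sort f).symm (e₀.symm ⟨x, hx⟩), by simp⟩
  · refine Fin.antitone_iff_succ_le.2 fun i => ?_
    rcases Fin.eq_zero_or_eq_succ i.castSucc with h0 | ⟨j, hj⟩
    · rw [h0]
      exact Set.subset_univ _
    · rw [hj]
      change G.singletonAttr _ ⊆ G.singletonAttr _
      -- The indices satisfy `j + 1 = i` as numbers.
      have hji : j ≤ i := by
        rw [Fin.le_def]
        have := congrArg Fin.val hj
        simp at this
        omega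
      have hcard : (G.singletonAttr (e₀ (Tuple.sort f i))).ncard ≤
          (G.singletonAttr (e₀ (Tuple.sort f j))).ncard := Tuple.monotone_sort f hji
      rcases h _ (e₀ (Tuple.sort f i)).2 _ (e₀ (Tuple.sort f j)).2 with h | h
      · exact h
      · exact (Set.eq_of_subset_of_ncard_le h hcard (Set.toFinite _)).ge

/-- The play after the visit to `F₀`: only `e 0, …, e (j - 1)` may be missing, and they are visited
in descending order of index. -/
theorem win_of_mem_attrSeq (hA : ∀ v ∈ G.arena.adam, (G.arena.succ v).Nonempty)
    {e : Fin G.T.card → V} (he : G.IsDescendingEnumeration e) (j : Fin (G.T.card + 1)) :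
    ∀ (vis : Set V) (v : V), v ∈ vis → v ∈ G.attrSeq e j → (∃ x ∈ vis, x ∈ G.F₀) →
      (∀ i : Fin G.T.card, j ≤ i.castSucc → e i ∈ vis) →
      G.arena.Win G.toGenReachGame.targets vis v := by
  induction j using Fin.induction with
  | zero =>
    intro vis v _ _ hF hT
    refine .done (forall_targets_iff.2 ⟨hF, fun t ht => ?_⟩)
    obtain ⟨i, rfl⟩ : t ∈ Set.range e := he.range_eq ▸ ht
    exact hT i (Fin.zero_le _)
  | succ j ih =>
    intro vis v hv hvj hF hT
    refine .of_mem_attr hA ?_ (hvj : v ∈ G.arena.attr {e j}) hv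
    rintro u rfl
    obtain ⟨x, hx, hxF⟩ := hF
    refine ih _ _ (Set.mem_insert _ _) (he.antitone Fin.castSucc_lt_succ.le (mem_attr_self _ _))
      ⟨x, .inr hx, hxF⟩ fun i hi => ?_
    rcases (Fin.castSucc_le_castSucc_iff.1 hi).eq_or_lt with rfl | hlt
    · exact Set.mem_insert _ _
    · exact .inr (hT i (Fin.succ_le_castSucc_iff.2 hlt))

/-- The play before the visit to `F₀`: Eve descends through the targets until index `i₀`, where
`base` makes the detour to `F₀` and hands over to `win_of_mem_attrSeq`. -/
theorem win_of_targetSeq (hA : ∀ v ∈ G.arena.adam, (G.arena.succ v).Nonempty)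
    {e : Fin G.T.card → V} (he : G.IsDescendingEnumeration e) {i₀ : Fin (G.T.card + 1)}
    (h₀ : G.targetSeq e i₀ ∈ G.arena.attr (G.attrSeq e i₀ ∩ (G.F₀ : Set V)))
    (j : Fin (G.T.card + 1)) :
    i₀ ≤ j → ∀ vis : Set V, G.targetSeq e j ∈ vis → G.targetSeq e j ∈ G.attrSeq e j →
      (∀ i : Fin G.T.card, j ≤ i.castSucc → e i ∈ vis) →
      G.arena.Win G.toGenReachGame.targets vis (G.targetSeq e j) := by
  have base : ∀ vis : Set V, G.targetSeq e i₀ ∈ vis →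
      (∀ i : Fin G.T.card, i₀ ≤ i.castSucc → e i ∈ vis) →
      G.arena.Win G.toGenReachGame.targets vis (G.targetSeq e i₀) := by
    intro vis hv hT
    refine .of_mem_attr hA ?_ h₀ hv
    rintro u ⟨hu, huF⟩
    exact win_of_mem_attrSeq hA he i₀ _ u (Set.mem_insert _ _) hu ⟨u, Set.mem_insert _ _, huF⟩
      fun i hi => .inr (hT i hi)
  induction j using Fin.induction with
  | zero =>
    intro hi vis hv _ hT
    obtain rfl : i₀ = 0 := le_antisymm hi (Fin.zero_le _)
    exact base vis hv hT
  | succ j ih =>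
    intro hi vis hv hvj hT
    rcases hi.eq_or_lt with rfl | hlt
    · exact base vis hv hT
    · have hj : G.targetSeq e j.castSucc = e j := by rw [targetSeq, Fin.snoc_castSucc]
      rw [hj] at ih
      refine .of_mem_attr hA ?_ (hvj : _ ∈ G.arena.attr {e j}) hv
      rintro u rfl
      refine ih (Fin.le_castSucc_iff.2 hlt) _ (Set.mem_insert _ _)
        (he.antitone Fin.castSucc_lt_succ.le (mem_attr_self _ _)) fun i hi => ?_
      rcases (Fin.castSucc_le_castSucc_iff.1 hi).eq_or_lt with rfl | hlt
      · exact Set.mem_insert _ _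
      · exact .inr (hT i (Fin.succ_le_castSucc_iff.2 hlt))

theorem eveWins_iff_win :
    G.EveWins ↔ G.arena.Win G.toGenReachGame.targets {G.start} G.start :=
  G.toGenReachGame.eveWins_iff_win

theorem eveWins_of_enumeration (hA : ∀ v ∈ G.arena.adam, (G.arena.succ v).Nonempty)
    {e : Fin G.T.card → V} (he : G.IsDescendingEnumeration e) (hs : G.StartInSmallest e)
    (hF : G.SomeTargetReachesF₀ e) : G.EveWins := by
  obtain ⟨i₀, h₀⟩ := hF
  have hlast : G.targetSeq e (Fin.last _) = G.start := by rw [targetSeq, Fin.snoc_last]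
  have := win_of_targetSeq hA he h₀ (Fin.last _) (Fin.le_last _) {G.start}
  rw [hlast] at this
  refine eveWins_iff_win.2 (this rfl hs fun i hi => ?_)
  exact absurd hi (not_le.2 (Fin.castSucc_lt_last i))

theorem Criterion.eveWins (hA : ∀ v ∈ G.arena.adam, (G.arena.succ v).Nonempty)
    (h : G.Criterion) : G.EveWins := by
  obtain ⟨e, he⟩ := exists_isDescendingEnumeration h.attractorsFormChain
  exact eveWins_of_enumeration hA he (h.startInSmallest he) (h.someTargetReachesF₀ he)

theorem eveWins_iff_criterion (hA : ∀ v ∈ G.arena.adam, (G.arena.succ v).Nonempty) :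
    G.EveWins ↔ G.Criterion :=
  ⟨fun h => criterion_of_win (eveWins_iff_win.1 h), fun h => h.eveWins hA⟩

theorem eveWins_iff_exists_enumeration (hA : ∀ v ∈ G.arena.adam, (G.arena.succ v).Nonempty) :
    G.EveWins ↔ G.AttractorsFormChain ∧ ∃ e : Fin G.T.card → V,
      G.IsDescendingEnumeration e ∧ G.StartInSmallest e ∧ G.SomeTargetReachesF₀ e := by
  constructor
  · intro h
    have hC := (eveWins_iff_criterion hA).1 h
    obtain ⟨e, he⟩ := exists_isDescendingEnumeration hC.attractorsFormChain
    exact ⟨hC.attractorsFormChain, e, he, hC.startInSmallest he, hC.someTargetReachesF₀ he⟩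
  · rintro ⟨-, e, he, hs, hF⟩
    exact eveWins_of_enumeration hA he hs hF

theorem eveWins_iff_forall_enumeration (hA : ∀ v ∈ G.arena.adam, (G.arena.succ v).Nonempty) :
    G.EveWins ↔ G.AttractorsFormChain ∧ ∀ e : Fin G.T.card → V,
      G.IsDescendingEnumeration e → G.StartInSmallest e ∧ G.SomeTargetReachesF₀ e := by
  constructor
  · intro h
    have hC := (eveWins_iff_criterion hA).1 h
    exact ⟨hC.attractorsFormChain,
      fun e he => ⟨hC.startInSmallest he, hC.someTargetReachesF₀ he⟩⟩
  · rintro ⟨hc, h⟩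
    obtain ⟨e, he⟩ := exists_isDescendingEnumeration hc
    exact eveWins_of_enumeration hA he (h e he).1 (h e he).2

end OneLargeTargetGame

/-! ### Sweeps over a grid of cells -/

namespace GridMachine

open Function StackCode

/-- Indices of vertex variables. -/
abbrev VarIdx := Fin 5

/-- Indices of tables, that is, of binary relations on vertices. -/
abbrev TabIdx := Fin 10

/-- Indices of registers. -/
abbrev RegIdx := Fin 8

/-- The contents of the registers. -/
abbrev Reg := RegIdx → Bool

/-- A cell of the grid. It stores whether it lies in the first row or column, which variables
have its row and its column as their value, and one bit of each table. -/
structure Cell where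
  firstRow : Bool
  firstCol : Bool
  row : VarIdx → Bool
  col : VarIdx → Bool
  tab : TabIdx → Bool

/-- The part of the internal state that a sweep may change. -/
structure Mem where
  reg : Reg
  prevRow : Bool
  thisRow : Bool
  prevCol : Bool
  flag : Bool

/-- The internal state: the memory together with buffers for stack symbols. -/
structure Ctrl where
  mem : Mem
  cell : Option Cell
  bit : Option Bool

instance : Finite Cell :=
  Finite.of_injective (fun c => (c.firstRow, c.firstCol, c.row, c.col, c.tab)) fun c d h => by
    cases c; cases d; simp_all

instance : Finite Mem :=
  Finite.of_injective (fun m => (m.reg, m.prevRow, m.thisRow, m.prevCol, m.flag)) fun c d h => by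
    cases c; cases d; simp_all

instance : Finite Ctrl :=
  Finite.of_injective (fun m => (m.mem, m.cell, m.bit)) fun c d h => by
    cases c; cases d; simp_all

/-- The stacks: the input, two stacks that hold the grid, and three counters. -/
inductive Stack
  | inp | fwd | bwd | cntA | cntB | cntC
  deriving DecidableEq

instance : Fintype Stack where
  elems := {.inp, .fwd, .bwd, .cntA, .cntB, .cntC}
  complete k := by cases k <;> simp

/-- The stack alphabets. -/
abbrev Alphabet : Stack → Type
  | .inp => Bool
  | .fwd => Cell
  | .bwd => Cell
  | .cntA => Bool
  | .cntB => Bool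
  | .cntC => Bool

/-- The family of stacks with the given contents. -/
def stk (i : List Bool) (f b : List Cell) (x y z : List Bool) : ∀ k, List (Alphabet k)
  | .inp => i
  | .fwd => f
  | .bwd => b
  | .cntA => x
  | .cntB => y
  | .cntC => z

section stk

variable (i : List Bool) (f b : List Cell) (x y z : List Bool)

theorem update_inp (l : List Bool) :
    update (stk i f b x y z) .inp l = stk l f b x y z := by
  funext k; cases k <;> rfl

theorem update_fwd (l : List Cell) :
    update (stk i f b x y z) .fwd l = stk i l b x y z := by
  funext k; cases k <;> rfl

theorem update_bwd (l : List Cell) :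
    update (stk i f b x y z) .bwd l = stk i f l x y z := by
  funext k; cases k <;> rfl

theorem update_cntA (l : List Bool) :
    update (stk i f b x y z) .cntA l = stk i f b l y z := by
  funext k; cases k <;> rfl

theorem update_cntB (l : List Bool) :
    update (stk i f b x y z) .cntB l = stk i f b x l z := by
  funext k; cases k <;> rfl

theorem update_cntC (l : List Bool) :
    update (stk i f b x y z) .cntC l = stk i f b x y l := by
  funext k; cases k <;> rfl

end stk

/-- Programs over these stacks. -/
abbrev Code := StackCode Alphabet Ctrl

theorem Runs.of_eq {c : Code} {v v' v'' : Ctrl} {S S' S'' : ∀ k, List (Alphabet k)} {t t' : ℕ}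
    (h : Runs c v S v' S' t) (hv : v' = v'') (hS : S' = S'') (ht : t = t') :
    Runs c v S v'' S'' t' := by
  subst hv hS ht; exact h

section basic

variable (v : Ctrl) (i : List Bool) (f b : List Cell) (x y z : List Bool)

theorem runs_pop_inp (g : Ctrl → Option Bool → Ctrl) :
    Runs (pop (Γ := Alphabet) .inp g) v (stk i f b x y z)
      (g v i.head?) (stk i.tail f b x y z) 1 :=
  Runs.of_eq (.pop ..) rfl (update_inp ..) rfl

theorem runs_pop_fwd (g : Ctrl → Option Cell → Ctrl) :
    Runs (pop (Γ := Alphabet) .fwd g) v (stk i f b x y z)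
      (g v f.head?) (stk i f.tail b x y z) 1 :=
  Runs.of_eq (.pop ..) rfl (update_fwd ..) rfl

theorem runs_pop_bwd (g : Ctrl → Option Cell → Ctrl) :
    Runs (pop (Γ := Alphabet) .bwd g) v (stk i f b x y z)
      (g v b.head?) (stk i f b.tail x y z) 1 :=
  Runs.of_eq (.pop ..) rfl (update_bwd ..) rfl

theorem runs_pop_cntA (g : Ctrl → Option Bool → Ctrl) :
    Runs (pop (Γ := Alphabet) .cntA g) v (stk i f b x y z)
      (g v x.head?) (stk i f b x.tail y z) 1 :=
  Runs.of_eq (.pop ..) rfl (update_cntA ..) rfl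

theorem runs_pop_cntB (g : Ctrl → Option Bool → Ctrl) :
    Runs (pop (Γ := Alphabet) .cntB g) v (stk i f b x y z)
      (g v y.head?) (stk i f b x y.tail z) 1 :=
  Runs.of_eq (.pop ..) rfl (update_cntB ..) rfl

theorem runs_pop_cntC (g : Ctrl → Option Bool → Ctrl) :
    Runs (pop (Γ := Alphabet) .cntC g) v (stk i f b x y z)
      (g v z.head?) (stk i f b x y z.tail) 1 :=
  Runs.of_eq (.pop ..) rfl (update_cntC ..) rfl

theorem runs_push_inp (g : Ctrl → Bool) :
    Runs (push (Γ := Alphabet) .inp g) v (stk i f b x y z) v (stk (g v :: i) f b x y z) 1 :=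
  Runs.of_eq (.push ..) rfl (update_inp ..) rfl

theorem runs_push_fwd (g : Ctrl → Cell) :
    Runs (push (Γ := Alphabet) .fwd g) v (stk i f b x y z) v (stk i (g v :: f) b x y z) 1 :=
  Runs.of_eq (.push ..) rfl (update_fwd ..) rfl

theorem runs_push_bwd (g : Ctrl → Cell) :
    Runs (push (Γ := Alphabet) .bwd g) v (stk i f b x y z) v (stk i f (g v :: b) x y z) 1 :=
  Runs.of_eq (.push ..) rfl (update_bwd ..) rfl

theorem runs_push_cntA (g : Ctrl → Bool) :
    Runs (push (Γ := Alphabet) .cntA g) v (stk i f b x y z) v (stk i f b (g v :: x) y z) 1 :=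
  Runs.of_eq (.push ..) rfl (update_cntA ..) rfl

theorem runs_push_cntB (g : Ctrl → Bool) :
    Runs (push (Γ := Alphabet) .cntB g) v (stk i f b x y z) v (stk i f b x (g v :: y) z) 1 :=
  Runs.of_eq (.push ..) rfl (update_cntB ..) rfl

theorem runs_push_cntC (g : Ctrl → Bool) :
    Runs (push (Γ := Alphabet) .cntC g) v (stk i f b x y z) v (stk i f b x y (g v :: z)) 1 :=
  Runs.of_eq (.push ..) rfl (update_cntC ..) rfl

end basic

/-- An empty cell. -/
def Cell.blank (firstRow firstCol : Bool) : Cell :=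
  ⟨firstRow, firstCol, fun _ => false, fun _ => false, fun _ => false⟩

/-- The cell in the buffer. -/
def Ctrl.getCell (v : Ctrl) : Cell := v.cell.getD (.blank false false)

/-- A finite-state transducer over cells, applied to a list. -/
def transduce (g : Mem → Cell → Mem × Cell) : Mem → List Cell → Mem × List Cell
  | m, [] => (m, [])
  | m, c :: l =>
    let r := transduce g (g m c).1 l
    (r.1, (g m c).2 :: r.2)

theorem transduce_append (g : Mem → Cell → Mem × Cell) (m : Mem) (l l' : List Cell) :
    transduce g m (l ++ l') = ((transduce g (transduce g m l).1 l').1,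
      (transduce g m l).2 ++ (transduce g (transduce g m l).1 l').2) := by
  induction l generalizing m with
  | nil => rfl
  | cons c l ih => simp [transduce, ih]

theorem transduce_length (g : Mem → Cell → Mem × Cell) (m : Mem) (l : List Cell) :
    (transduce g m l).2.length = l.length := by
  induction l generalizing m with
  | nil => rfl
  | cons c l ih => simp [transduce, ih]

/-- Moves the cells from the first grid stack to the second one through a transducer. -/
def sweepForth (g : Mem → Cell → Mem × Cell) : Code :=
  seq (pop .fwd fun v a => { v with cell := a })
    (loop (fun v => v.cell.isSome)
      (seq (load fun v => { v with mem := (g v.mem v.getCell).1, cell := (g v.mem v.getCell).2 })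
        (seq (push .bwd fun v => v.getCell) (pop .fwd fun v a => { v with cell := a }))))

/-- Moves the cells from the second grid stack back to the first one. -/
def sweepBack : Code :=
  seq (pop .bwd fun v a => { v with cell := a })
    (loop (fun v => v.cell.isSome)
      (seq (push .fwd fun v => v.getCell) (pop .bwd fun v a => { v with cell := a })))

variable {i : List Bool} {x y z : List Bool}

theorem runs_sweepForth (g : Mem → Cell → Mem × Cell) (v : Ctrl) (l r : List Cell) :
    Runs (sweepForth g) v (stk i l r x y z)
      ⟨(transduce g v.mem l).1, none, v.bit⟩
      (stk i [] ((transduce g v.mem l).2.reverse ++ r) x y z) (4 * l.length + 2) := by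
  refine Runs.of_eq (.seq (runs_pop_fwd ..) (t' := 4 * l.length + 1) ?_) rfl rfl (by omega)
  induction l generalizing v r with
  | nil => exact .loop_exit rfl
  | cons c l ih =>
    refine Runs.of_eq (.loop_iter rfl (.seq (.load ..) (.seq (runs_push_bwd ..)
      (runs_pop_fwd ..))) (ih _ _)) rfl ?_ (by simp; omega)
    simp [transduce, Ctrl.getCell]

theorem runs_sweepBack (v : Ctrl) (l r : List Cell) :
    Runs sweepBack v (stk i l r x y z) ⟨v.mem, none, v.bit⟩
      (stk i (r.reverse ++ l) [] x y z) (3 * r.length + 2) := by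
  refine Runs.of_eq (.seq (runs_pop_bwd ..) (t' := 3 * r.length + 1) ?_) rfl rfl (by omega)
  induction r generalizing v l with
  | nil => exact .loop_exit rfl
  | cons c r ih =>
    refine Runs.of_eq (.loop_iter rfl (.seq (runs_push_fwd ..) (runs_pop_bwd ..)) (ih _ _))
      rfl ?_ (by simp; omega)
    simp [Ctrl.getCell]

/-- Applies a transducer to the grid. -/
def sweep (g : Mem → Cell → Mem × Cell) : Code := seq (sweepForth g) sweepBack

theorem runs_sweep (g : Mem → Cell → Mem × Cell) (v : Ctrl) (l : List Cell) :
    Runs (sweep g) v (stk i l [] x y z)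
      ⟨(transduce g v.mem l).1, none, v.bit⟩
      (stk i (transduce g v.mem l).2 [] x y z) (7 * l.length + 4) :=
  Runs.of_eq (.seq (runs_sweepForth ..) (runs_sweepBack ..)) rfl (by simp)
    (by simp [transduce_length]; omega)

/-! ### The grid -/

/-- The tables, as binary relations on vertices. -/
abbrev Tables := TabIdx → ℕ → ℕ → Bool

/-- The values of the variables. -/
abbrev Env := VarIdx → ℕ

/-- The cell at row `u` and column `w`. -/
def gridCell (e : Env) (R : Tables) (u w : ℕ) : Cell where
  firstRow := decide (u = 0)
  firstCol := decide (w = 0)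
  row a := decide (e a = u)
  col a := decide (e a = w)
  tab j := R j u w

/-- The first `m` rows of the grid with `n` columns. -/
def gridRows (n m : ℕ) (e : Env) (R : Tables) : List Cell :=
  (List.range m).flatMap fun u => (List.range n).map (gridCell e R u)

/-- The square grid. -/
def grid (n : ℕ) (e : Env) (R : Tables) : List Cell := gridRows n n e R

theorem gridRows_succ (n m : ℕ) (e : Env) (R : Tables) :
    gridRows n (m + 1) e R = gridRows n m e R ++ (List.range n).map (gridCell e R m) := by
  simp [gridRows, List.range_succ]

theorem length_gridRows (n m : ℕ) (e : Env) (R : Tables) :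
    (gridRows n m e R).length = m * n := by
  induction m with
  | zero => simp [gridRows]
  | succ m ih => simp [gridRows_succ, ih, Nat.succ_mul]

theorem length_grid (n : ℕ) (e : Env) (R : Tables) : (grid n e R).length = n * n :=
  length_gridRows ..

theorem mem_grid {n : ℕ} {e : Env} {R : Tables} {c : Cell} :
    c ∈ grid n e R ↔ ∃ u < n, ∃ w < n, gridCell e R u w = c := by
  simp [grid, gridRows]

theorem transduce_map (h : Mem → Cell → Cell) (m : Mem) (l : List Cell) :
    transduce (fun m c => (m, h m c)) m l = (m, l.map (h m)) := by
  induction l with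
  | nil => rfl
  | cons c l ih => simp [transduce, ih]

theorem map_grid (n : ℕ) (e e' : Env) (R R' : Tables) (h : Cell → Cell)
    (hh : ∀ u < n, ∀ w < n, h (gridCell e R u w) = gridCell e' R' u w) :
    (grid n e R).map h = grid n e' R' := by
  simp only [grid, gridRows, List.map_flatMap, List.map_map]
  refine List.flatMap_congr fun u hu => List.map_congr_left fun w hw => ?_
  exact hh u (List.mem_range.1 hu) w (List.mem_range.1 hw)

/-! ### Reading and writing table entries -/

/-- The transducer that reads a table entry into a register. -/
def getStep (j : TabIdx) (a b : VarIdx) (k : RegIdx) (m : Mem) (c : Cell) : Mem × Cell :=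
  (if c.row a && c.col b then { m with reg := update m.reg k (c.tab j) } else m, c)

theorem transduce_getStep (j : TabIdx) (a b : VarIdx) (k : RegIdx) (m : Mem) (l : List Cell)
    (r : Bool) (hr : ∀ c ∈ l, (c.row a && c.col b) = true → c.tab j = r) :
    transduce (getStep j a b k) m l =
      (if l.any fun c => c.row a && c.col b then { m with reg := update m.reg k r } else m, l) := by
  induction l generalizing m with
  | nil => simp [transduce]
  | cons c l ih =>
    simp only [List.forall_mem_cons] at hr
    simp only [transduce, ih _ hr.2, List.any_cons]
    by_cases hc : (c.row a && c.col b) = true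
    · simp [getStep, hc, hr.1 hc]
    · simp [getStep, hc]

/-- Exactly one cell carries both marks if the two variables are in range, and none otherwise. -/
theorem transduce_getStep_grid (n : ℕ) (e : Env) (R : Tables) (j : TabIdx) (a b : VarIdx)
    (k : RegIdx) (m : Mem) :
    transduce (getStep j a b k) m (grid n e R) =
      (if e a < n ∧ e b < n then { m with reg := update m.reg k (R j (e a) (e b)) } else m,
        grid n e R) := by
  rw [transduce_getStep j a b k m _ (R j (e a) (e b))]
  · congr 1
    refine if_congr ?_ rfl rfl
    simp [List.any_eq_true, mem_grid, gridCell]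
  · intro c hc
    obtain ⟨u, -, w, -, rfl⟩ := mem_grid.1 hc
    simp only [gridCell, Bool.and_eq_true, decide_eq_true_eq]
    rintro ⟨rfl, rfl⟩
    rfl

/-- The cell after a register has been written to the selected entry of a table. -/
def putCell (j : TabIdx) (a b : VarIdx) (k : RegIdx) (m : Mem) (c : Cell) : Cell :=
  if c.row a && c.col b then { c with tab := update c.tab j (m.reg k) } else c

/-- The tables after an entry has been set. -/
def setEntry (R : Tables) (j : TabIdx) (u w : ℕ) (r : Bool) : Tables :=
  fun j' u' w' => if j' = j ∧ u' = u ∧ w' = w then r else R j' u' w'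

theorem map_putCell_grid (n : ℕ) (e : Env) (R : Tables) (j : TabIdx) (a b : VarIdx)
    (k : RegIdx) (m : Mem) :
    (grid n e R).map (putCell j a b k m) = grid n e (setEntry R j (e a) (e b) (m.reg k)) := by
  refine map_grid _ _ _ _ _ _ fun u _ w _ => ?_
  simp only [putCell, gridCell, Bool.and_eq_true, decide_eq_true_eq, setEntry]
  split_ifs with h
  · obtain ⟨rfl, rfl⟩ := h
    congr 1
    funext j'
    simp [update_apply]
  · congr 1
    funext j'
    rw [if_neg]
    rintro ⟨-, rfl, rfl⟩
    exact h ⟨rfl, rfl⟩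

/-! ### Changing the value of a variable -/

/-- The transducer that sets a variable to the first vertex. It raises the flag if there is a
vertex. -/
def resetStep (a : VarIdx) (m : Mem) (c : Cell) : Mem × Cell :=
  ({ m with flag := true },
    { c with row := update c.row a c.firstRow, col := update c.col a c.firstCol })

theorem transduce_resetStep (a : VarIdx) (m : Mem) (l : List Cell) :
    transduce (resetStep a) m l = ({ m with flag := m.flag || decide (0 < l.length) },
      l.map fun c => (resetStep a m c).2) := by
  induction l generalizing m with
  | nil => simp [transduce]
  | cons c l ih => simp [transduce, ih, resetStep]

theorem transduce_resetStep_grid (n : ℕ) (e : Env) (R : Tables) (a : VarIdx) (m : Mem)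
    (hm : m.flag = false) :
    transduce (resetStep a) m (grid n e R) =
      ({ m with flag := decide (0 < n) }, grid n (update e a 0) R) := by
  rw [transduce_resetStep]
  refine Prod.ext ?_ (map_grid _ _ _ _ _ _ fun u _ w _ => ?_)
  · simp [hm, length_grid, Nat.pos_iff_ne_zero]
  · simp only [resetStep, gridCell]
    congr 1 <;>
    · funext b
      by_cases hb : b = a
      · subst hb; simp [eq_comm]
      · simp [hb]

/-- The transducer that moves a variable to the next vertex. It raises the flag if there is a
next vertex. -/
def shiftStep (a : VarIdx) (m : Mem) (c : Cell) : Mem × Cell :=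
  let p := if c.firstCol then m.thisRow else m.prevRow
  let l := if c.firstCol then false else m.prevCol
  (⟨m.reg, p, c.row a, c.col a, m.flag || l⟩,
    { c with row := update c.row a p, col := update c.col a l })

theorem gridCell_shift (e : Env) (R : Tables) (a : VarIdx) (u w : ℕ) :
    gridCell (update e a (e a + 1)) R u w =
      { gridCell e R u w with
        row := update (gridCell e R u w).row a (decide (e a + 1 = u))
        col := update (gridCell e R u w).col a (decide (e a + 1 = w)) } := by
  simp only [gridCell]
  congr 1 <;>
  · funext b
    by_cases hb : b = a
    · subst hb; simp
    · simp [hb]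

/-- When a row begins, `thisRow` still holds the old mark of the row before, which is why `hm`
speaks of `e a + 1`; the first column copies it to `prevRow`. The bit `prevCol` delays the old
column mark by one cell. -/
theorem transduce_shiftStep_row (n : ℕ) (e : Env) (R : Tables) (a : VarIdx) (m : Mem) (u : ℕ)
    (hm : m.thisRow = decide (e a + 1 = u)) :
    transduce (shiftStep a) m ((List.range n).map (gridCell e R u)) =
      (if n = 0 then m else
        ⟨m.reg, decide (e a + 1 = u), decide (e a = u), decide (e a + 1 = n),
          m.flag || decide (e a + 1 < n)⟩,
        (List.range n).map (gridCell (update e a (e a + 1)) R u)) := by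
  induction n with
  | zero => simp [transduce]
  | succ n ih =>
    rw [List.range_succ, List.map_append, transduce_append, ih, List.map_append]
    simp only [List.map_cons, List.map_nil, transduce, gridCell_shift]
    rcases Nat.eq_zero_or_pos n with rfl | hn
    · simp [shiftStep, gridCell, hm]
    · have hn' : n ≠ 0 := by omega
      simp only [hn', if_false, shiftStep, gridCell, decide_false, Nat.add_eq_zero_iff,
        one_ne_zero, and_false, Nat.add_right_cancel_iff]
      refine Prod.ext ?_ rfl
      simp only [Mem.mk.injEq, true_and, Bool.false_eq_true, if_false, Bool.or_assoc]
      congr 1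
      rw [Bool.eq_iff_iff]
      simp
      omega

theorem transduce_shiftStep_grid (n : ℕ) (e : Env) (R : Tables) (a : VarIdx) (m : Mem)
    (hm : m.thisRow = false) (hf : m.flag = false) :
    ∃ m', transduce (shiftStep a) m (grid n e R) = (m', grid n (update e a (e a + 1)) R) ∧
      m'.reg = m.reg ∧ m'.flag = decide (e a + 1 < n) := by
  -- The rows are processed one at a time; `thisRow` carries information across only if the rows are
  -- nonempty.
  suffices H : ∀ k, ∃ m', transduce (shiftStep a) m (gridRows n k e R) =
      (m', gridRows n k (update e a (e a + 1)) R) ∧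
      m'.reg = m.reg ∧ (0 < n → m'.thisRow = decide (e a + 1 = k)) ∧
      m'.flag = (decide (0 < k) && decide (e a + 1 < n)) by
    obtain ⟨m', h1, h2, -, h3⟩ := H n
    refine ⟨m', h1, h2, h3.trans ?_⟩
    rw [Bool.eq_iff_iff]
    simp
    omega
  intro k
  induction k with
  | zero => exact ⟨m, by simp [gridRows, transduce], rfl, by simp [hm], by simp [hf]⟩
  | succ k ih =>
    obtain ⟨m', h1, h2, h3, h4⟩ := ih
    rcases Nat.eq_zero_or_pos n with rfl | hn
    · exact ⟨m', by rw [gridRows_succ, transduce_append, h1]; simp [transduce, gridRows_succ], h2,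
        by simp, by simp [h4]⟩
    · refine ⟨⟨m'.reg, decide (e a + 1 = k), decide (e a = k), decide (e a + 1 = n),
          m'.flag || decide (e a + 1 < n)⟩, ?_, h2, by simp, ?_⟩
      · rw [gridRows_succ, transduce_append, h1, transduce_shiftStep_row _ _ _ _ _ _ (h3 hn),
          if_neg hn.ne', gridRows_succ]
      · simp only [h4, Nat.zero_lt_succ, decide_true, Bool.true_and]
        rcases decide (0 < k) <;> simp

end GridMachine

namespace GridMachine

open Function StackCode

/-! ### Construction of the grid -/

/-- Moves the leading ones of the input to two counters and removes the separator. -/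
def readUnary : Code :=
  seq (pop .inp fun v a => { v with bit := a })
    (loop (fun v => v.bit == some true)
      (seq (push .cntA fun _ => true) (seq (push .cntB fun _ => true)
        (pop .inp fun v a => { v with bit := a }))))

/-- One copy of `n` will count columns, the other rows. The pop that ends the loop also consumes the
separator, hence `w.tail`. -/
theorem runs_readUnary (v : Ctrl) (n : ℕ) (w : List Bool) (hw : w.head? ≠ some true)
    (f b : List Cell) (x y z : List Bool) :
    Runs readUnary v (stk (List.replicate n true ++ w) f b x y z) { v with bit := w.head? }
      (stk w.tail f b (List.replicate n true ++ x) (List.replicate n true ++ y) z)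
      (4 * n + 2) := by
  refine Runs.of_eq (.seq (runs_pop_inp ..) (t' := 4 * n + 1) ?_) rfl rfl (by omega)
  induction n generalizing v x y with
  | zero => exact .loop_exit (by simpa using hw)
  | succ n ih =>
    refine Runs.of_eq (.loop_iter rfl (.seq (runs_push_cntA ..) (.seq (runs_push_cntB ..)
      (runs_pop_inp ..))) (ih { v with bit := some true } _ _)) rfl ?_ (by omega)
    simp [List.replicate_succ']

/-- Adds a row of empty cells, as long as the first counter, to the second grid stack. -/
def buildRow : Code :=
  seq (load fun v => { v with mem := { v.mem with prevCol := true } })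
    (seq (pop .cntA fun v a => { v with bit := a })
      (seq (loop (fun v => v.bit.isSome)
          (seq (push .cntC fun _ => true)
            (seq (push .bwd fun v => .blank v.mem.flag v.mem.prevCol)
              (seq (load fun v => { v with mem := { v.mem with prevCol := false } })
                (pop .cntA fun v a => { v with bit := a })))))
        (seq (pop .cntC fun v a => { v with bit := a })
          (seq (loop (fun v => v.bit.isSome)
              (seq (push .cntA fun _ => true) (pop .cntC fun v a => { v with bit := a })))
            (load fun v => { v with mem := { v.mem with flag := false } })))))

theorem runs_buildRow (v : Ctrl) (n : ℕ) (i : List Bool) (f b : List Cell) (y : List Bool) :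
    ∃ v', Runs buildRow v (stk i f b (List.replicate n true) y []) v'
      (stk i f (((List.range' 0 n).map fun w => Cell.blank v.mem.flag (decide (w = 0))).reverse ++ b)
        (List.replicate n true) y []) (8 * n + 6) ∧ v'.mem.flag = false := by
  -- Here `c` is the column of the next cell and `k` the number of cells still to be made. During
  -- construction `prevCol` and `flag` serve as marks for the first column and row.
  have forth : ∀ (k c : ℕ) (v : Ctrl) (b : List Cell), v.mem.prevCol = decide (c = 0) →
      v.bit = (List.replicate k true).head? →
      ∃ v', v'.mem.flag = v.mem.flag ∧ Runs (loop (fun v => v.bit.isSome)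
          (seq (push .cntC fun _ => true)
            (seq (push .bwd fun v => .blank v.mem.flag v.mem.prevCol)
              (seq (load fun v => { v with mem := { v.mem with prevCol := false } })
                (pop .cntA fun v a => { v with bit := a }))))) v
        (stk i f b (List.replicate k true).tail y (List.replicate c true)) v'
        (stk i f (((List.range' c k).map fun w =>
          Cell.blank v.mem.flag (decide (w = 0))).reverse ++ b) [] y
          (List.replicate (c + k) true)) (5 * k + 1) := by
    intro k
    induction k with
    | zero => exact fun c v b _ hv => ⟨v, rfl, .loop_exit (by simp [hv])⟩
    | succ k ih =>
      intro c v b hc hv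
      obtain ⟨v', hv', hr⟩ := ih (c + 1)
        ⟨{ v.mem with prevCol := false }, v.cell, (List.replicate k true).head?⟩
        (Cell.blank v.mem.flag v.mem.prevCol :: b) (by simp) rfl
      refine ⟨v', hv', Runs.of_eq (.loop_iter (by simp [hv]) (.seq (runs_push_cntC ..)
        (.seq (runs_push_bwd ..) (.seq (.load ..) (runs_pop_cntA ..)))) hr) rfl ?_ (by omega)⟩
      simp [List.range'_succ, hc, Nat.add_comm, Nat.add_left_comm]
  have back : ∀ (k c : ℕ) (v : Ctrl) (b : List Cell), v.bit = (List.replicate k true).head? →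
      Runs (loop (fun v => v.bit.isSome)
          (seq (push .cntA fun _ => true) (pop .cntC fun v a => { v with bit := a }))) v
        (stk i f b (List.replicate c true) y (List.replicate k true).tail) { v with bit := none }
        (stk i f b (List.replicate (c + k) true) y []) (3 * k + 1) := by
    intro k
    induction k with
    | zero =>
      intro c v b hv
      obtain ⟨m, cell, bit⟩ := v
      obtain rfl : bit = none := hv
      exact .loop_exit rfl
    | succ k ih =>
      intro c v b hv
      refine Runs.of_eq (.loop_iter (by simp [hv]) (.seq (runs_push_cntA ..)
        (runs_pop_cntC ..)) (ih (c + 1) { v with bit := (List.replicate k true).head? } b rfl))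
        rfl ?_ (by omega)
      simp [Nat.add_comm, Nat.add_left_comm]
  obtain ⟨v', hv', hr⟩ := forth n 0
    ⟨{ v.mem with prevCol := true }, v.cell, (List.replicate n true).head?⟩ b rfl rfl
  rw [Nat.zero_add] at hr
  refine ⟨⟨{ v'.mem with flag := false }, v'.cell, none⟩,
    Runs.of_eq (.seq (.load ..) (.seq (runs_pop_cntA ..) (.seq hr (.seq (runs_pop_cntC ..)
      (.seq (back n 0 { v' with bit := (List.replicate n true).head? } _ rfl) (.load ..))))))
      rfl (by simp) (by omega) , rfl⟩

/-- Builds an empty grid from the counters. -/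
def buildGrid : Code :=
  seq (load fun v => { v with mem := { v.mem with flag := true } })
    (seq (pop .cntB fun v a => { v with bit := a })
      (seq (loop (fun v => v.bit.isSome)
          (seq buildRow (pop .cntB fun v a => { v with bit := a })))
        (seq (seq (pop .cntA fun v a => { v with bit := a })
            (loop (fun v => v.bit.isSome) (pop .cntA fun v a => { v with bit := a })))
          sweepBack)))

theorem runs_clear_cntA (v : Ctrl) (i : List Bool) (f b : List Cell) (x y z : List Bool) :
    Runs (seq (pop .cntA fun v a => { v with bit := a })
        (loop (fun v => v.bit.isSome) (pop .cntA fun v a => { v with bit := a })) : Code) v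
      (stk i f b x y z) { v with bit := none } (stk i f b [] y z) (2 * x.length + 2) := by
  refine Runs.of_eq (.seq (runs_pop_cntA ..) (t' := 2 * x.length + 1) ?_) rfl rfl (by omega)
  induction x generalizing v with
  | nil => exact .loop_exit rfl
  | cons c l ih =>
    exact Runs.of_eq (.loop_iter rfl (runs_pop_cntA ..) (ih { v with bit := some c })) rfl rfl
      (by simp; omega)

/-- The value `n` lies outside the grid, so blank cells represent variables that are all out of
range. -/
theorem gridRows_blank (n : ℕ) :
    grid n (fun _ => n) (fun _ _ _ => false) = (List.range' 0 n).flatMap fun u =>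
      (List.range' 0 n).map fun w => Cell.blank (decide (u = 0)) (decide (w = 0)) := by
  simp only [grid, gridRows, List.range_eq_range']
  refine List.flatMap_congr fun u hu => List.map_congr_left fun w hw => ?_
  simp only [List.mem_range'_1] at hu hw
  simp only [gridCell, Cell.blank, Cell.mk.injEq, true_and, and_true]
  constructor <;>
  · funext a
    simp
    omega

theorem runs_buildGrid (v : Ctrl) (n : ℕ) (i : List Bool) :
    ∃ v', Runs buildGrid v (stk i [] [] (List.replicate n true) (List.replicate n true) []) v'
      (stk i (grid n (fun _ => n) fun _ _ _ => false) [] [] [] [])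
      (n * (8 * n + 8) + 2 * n + 3 * (n * n) + 7) := by
  have rows : ∀ (k c : ℕ) (v : Ctrl) (b : List Cell), v.mem.flag = decide (c = 0) →
      v.bit = (List.replicate k true).head? →
      ∃ v', Runs (loop (fun v => v.bit.isSome)
          (seq buildRow (pop .cntB fun v a => { v with bit := a }))) v
        (stk i [] b (List.replicate n true) (List.replicate k true).tail []) v'
        (stk i [] (((List.range' c k).flatMap fun u => (List.range' 0 n).map fun w =>
          Cell.blank (decide (u = 0)) (decide (w = 0))).reverse ++ b)
          (List.replicate n true) [] []) (k * (8 * n + 8) + 1) := by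
    intro k
    induction k with
    | zero => exact fun c v b _ hv => ⟨v, Runs.of_eq (.loop_exit (by simp [hv])) rfl rfl (by simp)⟩
    | succ k ih =>
      intro c v b hc hv
      obtain ⟨v₁, hr₁, hv₁⟩ := runs_buildRow v n i [] b (List.replicate k true)
      obtain ⟨v', hr⟩ := ih (c + 1) { v₁ with bit := (List.replicate k true).head? }
        (((List.range' 0 n).map fun w =>
          Cell.blank v.mem.flag (decide (w = 0))).reverse ++ b) (by simpa using hv₁) rfl
      refine ⟨v', Runs.of_eq (.loop_iter (by simp [hv]) (.seq hr₁ (runs_pop_cntB ..)) hr) rfl ?_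
        (by rw [Nat.succ_mul k]; omega)⟩
      simp [List.range'_succ, hc]
  obtain ⟨v', hr⟩ := rows n 0
    ⟨{ v.mem with flag := true }, v.cell, (List.replicate n true).head?⟩ [] rfl rfl
  have hc := runs_clear_cntA v' i [] (((List.range' 0 n).flatMap fun u =>
    (List.range' 0 n).map fun w => Cell.blank (decide (u = 0)) (decide (w = 0))).reverse ++ [])
    (List.replicate n true) [] []
  rw [← gridRows_blank] at hc hr
  refine ⟨_, Runs.of_eq (.seq (.load ..) (.seq (runs_pop_cntB ..) (.seq hr (.seq hc
    (runs_sweepBack ..))))) rfl (by simp) ?_⟩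
  simp only [List.length_append, List.length_reverse, length_grid, List.length_nil,
    List.length_replicate]
  omega

/-! ### A language of loops over vertices -/

/-- Programs that read and write tables at positions given by variables, and whose loops run over
all vertices. -/
inductive Prog
  | get (j : TabIdx) (a b : VarIdx) (k : RegIdx)
  | put (j : TabIdx) (a b : VarIdx) (k : RegIdx)
  | load (f : Reg → Reg)
  | read (f : Reg → Option Bool → Reg)
  | seq (c d : Prog)
  | forEach (a : VarIdx) (c : Prog)

/-- The state on which programs operate: registers, the remaining input, and tables. -/
structure State where
  reg : Reg
  inp : List Bool
  tab : Tables

namespace Prog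

/-- The state after the execution of a program over the vertices `0, …, n - 1`. -/
def eval (n : ℕ) : Prog → Env → State → State
  | get j a b k, e, s =>
    { s with reg := if e a < n ∧ e b < n then update s.reg k (s.tab j (e a) (e b)) else s.reg }
  | put j a b k, e, s => { s with tab := setEntry s.tab j (e a) (e b) (s.reg k) }
  | load f, _, s => { s with reg := f s.reg }
  | read f, _, s => { s with reg := f s.reg s.inp.head?, inp := s.inp.tail }
  | seq c d, e, s => d.eval n e (c.eval n e s)
  | forEach a c, e, s => (List.range n).foldl (fun s i => c.eval n (update e a i) s) s

/-- The variables that occur freely. -/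
def free : Prog → VarIdx → Bool
  | get _ a b _, x => x == a || x == b
  | put _ a b _, x => x == a || x == b
  | load _, _ => false
  | read _, _ => false
  | seq c d, x => c.free x || d.free x
  | forEach a c, x => x != a && c.free x

/-- The loop variables. -/
def bound : Prog → VarIdx → Bool
  | get _ _ _ _, _ => false
  | put _ _ _ _, _ => false
  | load _, _ => false
  | read _, _ => false
  | seq c d, x => c.bound x || d.bound x
  | forEach a c, x => x == a || c.bound x

/-- In no subprogram a variable occurs both as a free variable and as a loop variable, and nested
loops have different variables. -/
def WellFormed : Prog → Prop
  | get _ _ _ _ => True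
  | put _ _ _ _ => True
  | load _ => True
  | read _ => True
  | seq c d => c.WellFormed ∧ d.WellFormed ∧ ∀ x, c.bound x = true → d.free x = false
  | forEach a c => c.WellFormed ∧ c.bound a = false ∧
      ∀ x, c.bound x = true → c.free x = false

/-- The compilation of programs to the stack machine. -/
def compile : Prog → Code
  | get j a b k => sweep (getStep j a b k)
  | put j a b k => sweep fun m c => (m, putCell j a b k m c)
  | load f => .load fun v => { v with mem := { v.mem with reg := f v.mem.reg } }
  | read f => .pop .inp fun v o => { v with mem := { v.mem with reg := f v.mem.reg o } }
  | seq c d => .seq c.compile d.compile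
  | forEach a c =>
    .seq (.load fun v => { v with mem := { v.mem with flag := false } })
      (.seq (sweep (resetStep a))
        (.loop (fun v => v.mem.flag)
          (.seq c.compile
            (.seq (.load fun v => { v with mem := { v.mem with flag := false, thisRow := false } })
              (sweep (shiftStep a))))))

open Polynomial in
/-- A bound on the running time. -/
noncomputable def cost : Prog → ℕ[X]
  | get _ _ _ _ => 7 * X ^ 2 + 4
  | put _ _ _ _ => 7 * X ^ 2 + 4
  | load _ => 1
  | read _ => 1
  | seq c d => c.cost + d.cost
  | forEach _ c => 7 * X ^ 2 + 6 + X * (c.cost + 7 * X ^ 2 + 6)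

/-- The machine does not restore loop variables, so its environment `e` is only required to agree
with the semantic one `e₀` on free variables. Well-formedness ensures that a variable altered by a
loop is not read as free afterwards, neither by the next program nor by the next iteration. -/
theorem runs_compile (P : Prog) (hP : P.WellFormed) (n : ℕ) (e₀ e : Env) (s : State) (v : Ctrl)
    (hv : v.mem.reg = s.reg) (he : ∀ x, P.free x = true → e x = e₀ x) :
    ∃ e' v' t, Runs P.compile v (stk s.inp (grid n e s.tab) [] [] [] []) v'
        (stk (P.eval n e₀ s).inp (grid n e' (P.eval n e₀ s).tab) [] [] [] []) t ∧
      v'.mem.reg = (P.eval n e₀ s).reg ∧ (∀ x, P.bound x = false → e' x = e x) ∧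
      t ≤ P.cost.eval n := by
  induction P generalizing e₀ e s v with
  | get j a b k =>
    have h := runs_sweep (i := s.inp) (x := []) (y := []) (z := []) (getStep j a b k) v
      (grid n e s.tab)
    rw [transduce_getStep_grid] at h
    have ha : e a = e₀ a := he a (by simp [free])
    have hb : e b = e₀ b := he b (by simp [free])
    refine ⟨e, _, _, h, ?_, fun _ _ => rfl, ?_⟩
    · simp only [eval, ha, hb]
      split_ifs <;> simp [hv]
    · simp [cost, length_grid, sq]
  | put j a b k =>
    have h := runs_sweep (i := s.inp) (x := []) (y := []) (z := [])
      (fun m c => (m, putCell j a b k m c)) v (grid n e s.tab)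
    have ha : e a = e₀ a := he a (by simp [free])
    have hb : e b = e₀ b := he b (by simp [free])
    rw [transduce_map, map_putCell_grid, ha, hb, hv] at h
    refine ⟨e, _, _, h, hv, fun _ _ => rfl, ?_⟩
    simp [cost, length_grid, sq]
  | load f => exact ⟨e, _, _, .load .., by simp [eval, hv], fun _ _ => rfl, by simp [cost]⟩
  | read f => exact ⟨e, _, _, runs_pop_inp .., by simp [eval, hv], fun _ _ => rfl, by simp [cost]⟩
  | seq c d ihc ihd =>
    obtain ⟨hc, hd, hcd⟩ := hP
    obtain ⟨e₁, v₁, t₁, h₁, hv₁, he₁, ht₁⟩ := ihc hc e₀ e s v hv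
      fun x hx => he x (by simp [free, hx])
    obtain ⟨e₂, v₂, t₂, h₂, hv₂, he₂, ht₂⟩ := ihd hd e₀ e₁ _ v₁ hv₁ fun x hx => by
      rw [he₁ x, he x (by simp [free, hx])]
      by_contra hb
      simp [hcd x (by simpa using hb)] at hx
    refine ⟨e₂, v₂, _, .seq h₁ h₂, hv₂, fun x hx => ?_, ?_⟩
    · simp only [bound, Bool.or_eq_false_iff] at hx
      rw [he₂ x hx.2, he₁ x hx.1]
    · simp only [cost, Polynomial.eval_add]
      omega
  | forEach a c ih =>
    obtain ⟨hc, hac, hbf⟩ := hP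
    -- The situation at the loop test, with `k` iterations left: the variable has the value `i`, and
    -- the flag tells whether this is still a vertex.
    have main : ∀ (k i : ℕ) (e : Env) (s : State) (v : Ctrl), i + k = n → v.mem.reg = s.reg →
        v.mem.flag = decide (i < n) → e a = i →
        (∀ x, x ≠ a → c.free x = true → e x = e₀ x) →
        ∃ e' v' t, Runs (.loop (fun v => v.mem.flag)
            (.seq c.compile
              (.seq (.load fun v =>
                { v with mem := { v.mem with flag := false, thisRow := false } })
                (sweep (shiftStep a))))) v (stk s.inp (grid n e s.tab) [] [] [] []) v'
          (stk ((List.range' i k).foldl (fun s i => c.eval n (update e₀ a i) s) s).inp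
            (grid n e' ((List.range' i k).foldl (fun s i => c.eval n (update e₀ a i) s) s).tab)
            [] [] [] []) t ∧
          v'.mem.reg = ((List.range' i k).foldl (fun s i => c.eval n (update e₀ a i) s) s).reg ∧
          (∀ x, x ≠ a → c.bound x = false → e' x = e x) ∧
          t ≤ 1 + k * (c.cost.eval n + 7 * n ^ 2 + 6) := by
      intro k
      induction k with
      | zero =>
        intro i e s v hi hv hf _ _
        exact ⟨e, v, 1, .loop_exit (by rw [hf]; simp; omega), hv, fun _ _ _ => rfl, by simp⟩
      | succ k ihk =>
        intro i e s v hi hv hf hea he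
        obtain ⟨e₁, v₁, t₁, h₁, hv₁, he₁, ht₁⟩ := ih hc (update e₀ a i) e s v hv fun x hx => by
          by_cases hxa : x = a
          · subst hxa; simp [hea]
          · simp [hxa, he x hxa hx]
        have ha₁ : e₁ a = i := by rw [he₁ a hac, hea]
        set s₁ := c.eval n (update e₀ a i) s with hs₁
        obtain ⟨m, hm, hmr, hmf⟩ := transduce_shiftStep_grid n e₁ s₁.tab a
          { v₁.mem with flag := false, thisRow := false } rfl rfl
        have hsw := runs_sweep (i := s₁.inp) (x := []) (y := []) (z := []) (shiftStep a)
          { v₁ with mem := { v₁.mem with flag := false, thisRow := false } } (grid n e₁ s₁.tab)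
        rw [hm] at hsw
        obtain ⟨e', v', t, h', hv', he', ht⟩ := ihk (i + 1) (update e₁ a (e₁ a + 1)) s₁
          ⟨m, none, v₁.bit⟩ (by omega) (by rw [← hv₁]; exact hmr) (by simp [hmf, ha₁])
          (by simp [ha₁]) fun x hxa hx => by
            rw [update_of_ne hxa, he₁ x, he x hxa hx]
            by_contra hb
            simp [hbf x (by simpa using hb)] at hx
        refine ⟨e', v', _, .loop_iter (by rw [hf]; simp; omega)
          (.seq h₁ (.seq (.load ..) hsw)) h', hv', fun x hxa hx => ?_, ?_⟩
        · rw [he' x hxa hx, update_of_ne hxa, he₁ x hx]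
        · rw [length_grid, Nat.succ_mul k]
          rw [← sq]
          omega
    have hsw := runs_sweep (i := s.inp) (x := []) (y := []) (z := []) (resetStep a)
      { v with mem := { v.mem with flag := false } } (grid n e s.tab)
    rw [transduce_resetStep_grid _ _ _ _ _ rfl] at hsw
    obtain ⟨e', v', t, h', hv', he', ht⟩ := main n 0 (update e a 0) s
      ⟨{ v.mem with flag := decide (0 < n) }, none, v.bit⟩ (by omega) hv rfl (by simp)
      fun x hxa hx => by rw [update_of_ne hxa, he x (by simp [free, hxa, hx])]
    simp only [eval, List.range_eq_range']
    refine ⟨e', v', _, .seq (.load ..) (.seq hsw h'), hv', fun x hx => ?_, ?_⟩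
    · simp only [bound, Bool.or_eq_false_iff, beq_eq_false_iff_ne] at hx
      rw [he' x hx.1 hx.2, update_of_ne hx.1]
    · simp only [cost, length_grid, Polynomial.eval_add, Polynomial.eval_mul, Polynomial.eval_pow,
        Polynomial.eval_X, Polynomial.eval_ofNat]
      rw [← sq]
      omega

end Prog

/-! ### Deciding languages -/

/-- Empties the stacks and outputs the given function of the registers. -/
def answer (v₀ : Ctrl) (acc : Reg → Bool) : Code :=
  .seq (.seq (.pop .inp fun v a => { v with bit := a })
      (.loop (fun v => v.bit.isSome) (.pop .inp fun v a => { v with bit := a })))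
    (.seq (.seq (.pop .fwd fun v a => { v with cell := a })
        (.loop (fun v => v.cell.isSome) (.pop .fwd fun v a => { v with cell := a })))
      (.seq (.push .inp fun v => acc v.mem.reg) (.load fun _ => v₀)))

theorem runs_answer (v₀ v : Ctrl) (acc : Reg → Bool) (i : List Bool) (f : List Cell) :
    Runs (answer v₀ acc) v (stk i f [] [] [] []) v₀ (stk [acc v.mem.reg] [] [] [] [] [])
      (2 * i.length + 2 * f.length + 6) := by
  have h₁ : Runs (.seq (.pop .inp fun v a => { v with bit := a })
      (.loop (fun v => v.bit.isSome) (.pop .inp fun v a => { v with bit := a })) : Code) v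
      (stk i f [] [] [] []) { v with bit := none } (stk [] f [] [] [] []) (2 * i.length + 2) := by
    refine Runs.of_eq (.seq (runs_pop_inp ..) (t' := 2 * i.length + 1) ?_) rfl rfl (by omega)
    induction i generalizing v with
    | nil => exact .loop_exit rfl
    | cons c l ih =>
      exact Runs.of_eq (.loop_iter rfl (runs_pop_inp ..) (ih { v with bit := some c })) rfl rfl
        (by simp; omega)
  have h₂ : ∀ v : Ctrl, Runs (.seq (.pop .fwd fun v a => { v with cell := a })
      (.loop (fun v => v.cell.isSome) (.pop .fwd fun v a => { v with cell := a })) : Code) v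
      (stk [] f [] [] [] []) { v with cell := none } (stk [] [] [] [] [] [])
      (2 * f.length + 2) := by
    clear h₁
    intro v
    refine Runs.of_eq (.seq (runs_pop_fwd ..) (t' := 2 * f.length + 1) ?_) rfl rfl (by omega)
    induction f generalizing v with
    | nil => exact .loop_exit rfl
    | cons c l ih =>
      exact Runs.of_eq (.loop_iter rfl (runs_pop_fwd ..) (ih { v with cell := some c })) rfl rfl
        (by simp; omega)
  exact Runs.of_eq (.seq h₁ (.seq (h₂ _) (.seq (runs_push_inp ..) (.load ..)))) rfl rfl
    (by omega)

/-- The initial internal state. -/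
def initialCtrl : Ctrl := ⟨⟨fun _ => false, false, false, false, false⟩, none, none⟩

/-- The program that builds the grid, executes `P`, and answers according to `acc`. -/
def decider (P : Prog) (acc : Reg → Bool) : Code :=
  .seq readUnary (.seq buildGrid
    (.seq (.load fun v => { v with mem := { v.mem with reg := fun _ => false } })
      (.seq P.compile (answer initialCtrl acc))))

/-- The state in which the main program is started: the input without its leading ones and the
separator, and empty tables. -/
def State.initial (w : List Bool) : State := ⟨fun _ => false, w.tail, fun _ _ _ => false⟩

/-- Needed to bound the time that `answer` spends on discarding unread input. -/
theorem Prog.length_inp_eval_le (P : Prog) (n : ℕ) (e : Env) (s : State) :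
    (P.eval n e s).inp.length ≤ s.inp.length := by
  induction P generalizing e s with
  | get | put | load => exact le_rfl
  | read => simp [eval]
  | seq c d ihc ihd => exact (ihd _ _).trans (ihc _ _)
  | forEach a c ih =>
    simp only [eval]
    generalize List.range n = l
    induction l generalizing s with
    | nil => exact le_rfl
    | cons i l ihl => exact (ihl _).trans (ih _ _)

theorem runs_decider (P : Prog) (hP : P.WellFormed) (hP' : ∀ x, P.free x = false)
    (acc : Reg → Bool) (n : ℕ) (w : List Bool) (hw : w.head? ≠ some true) :
    ∃ t, Runs (decider P acc) initialCtrl (stk (List.replicate n true ++ w) [] [] [] [] [])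
      initialCtrl (stk [acc (P.eval n (fun _ => 0) (.initial w)).reg] [] [] [] [] []) t ∧
      t ≤ P.cost.eval n + (13 * n ^ 2 + 14 * n + 2 * w.length + 16) := by
  obtain ⟨v₁, h₁⟩ := runs_buildGrid { initialCtrl with bit := w.head? } n w.tail
  obtain ⟨e, v, t, h, hv, -, ht⟩ := P.runs_compile hP n (fun _ => 0) (fun _ => n) (.initial w)
    { v₁ with mem := { v₁.mem with reg := fun _ => false } } rfl fun x hx => by simp [hP'] at hx
  have hu := runs_readUnary initialCtrl n w hw [] [] [] [] []
  rw [List.append_nil] at hu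
  have ha := runs_answer initialCtrl v acc (P.eval n (fun _ => 0) (.initial w)).inp
    (grid n e (P.eval n (fun _ => 0) (.initial w)).tab)
  rw [hv] at ha
  refine ⟨_, .seq hu (.seq h₁ (.seq (.load ..) (.seq h ha))), ?_⟩
  have hl := P.length_inp_eval_le n (fun _ => 0) (.initial w)
  have hl' : (State.initial w).inp.length ≤ w.length := by simp [State.initial]
  rw [length_grid]
  have : n * (8 * n + 8) = 8 * n ^ 2 + 8 * n := by ring
  rw [this, ← sq]
  omega

theorem Polynomial.eval_le_eval (p : Polynomial ℕ) {m n : ℕ} (h : m ≤ n) :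
    p.eval m ≤ p.eval n := by
  simp only [Polynomial.eval_eq_sum, Polynomial.sum]
  gcongr

theorem exists_replicate_append (w : List Bool) :
    ∃ n w', w = List.replicate n true ++ w' ∧ w'.head? ≠ some true := by
  induction w with
  | nil => exact ⟨0, [], rfl, by simp⟩
  | cons b w ih =>
    obtain ⟨n, w', rfl, hw'⟩ := ih
    cases b with
    | false => exact ⟨0, _, rfl, by simp⟩
    | true => exact ⟨n + 1, w', by simp [List.replicate_succ], hw'⟩

/-- A language is in P if its words are recognised by a program, started on the grid whose size
is the number of leading ones of the word. -/
theorem inP_of_prog (L : Language Bool) (P : Prog) (hP : P.WellFormed)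
    (hP' : ∀ x, P.free x = false) (acc : Reg → Bool)
    (hL : ∀ (n : ℕ) (w : List Bool), w.head? ≠ some true →
      (acc (P.eval n (fun _ => 0) (.initial w)).reg = true ↔ List.replicate n true ++ w ∈ L)) :
    InP L := by
  classical
  let : Fintype (Alphabet .inp) := inferInstanceAs (Fintype Bool)
  -- The time bound comes from `runs_decider`, with both `n` and the length of the rest replaced by
  -- the input length; `17` is its `16` plus the halting step.
  have main : ∀ w : List Bool, Nonempty (Turing.TM2OutputsInTime
      (machine (Γ := Alphabet) Stack.inp initialCtrl (decider P acc)) w (some [decide (w ∈ L)])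
      ((P.cost + (13 * Polynomial.X ^ 2 + 14 * Polynomial.X + 2 * Polynomial.X + 17)).eval
        w.length)) := by
    intro w
    obtain ⟨n, w', rfl, hw'⟩ := exists_replicate_append w
    obtain ⟨t, h, ht⟩ := runs_decider P hP hP' acc n w' hw'
    have hacc : acc (P.eval n (fun _ => 0) (.initial w')).reg =
        decide (List.replicate n true ++ w' ∈ L) := by
      rw [Bool.eq_iff_iff, hL n w' hw', decide_eq_true_iff]
    have hstk (l : List Bool) :
        stk l [] [] [] [] [] =
          (update (fun _ => []) Stack.inp l : ∀ k, List (Alphabet k)) := by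
      funext k; cases k <;> rfl
    rw [hacc, hstk, hstk] at h
    obtain ⟨o⟩ := h.machine_outputs
    refine ⟨⟨o.toEvalsTo, o.steps_le_m.trans ?_⟩⟩
    have hn : n ≤ (List.replicate n true ++ w').length := by simp
    have hw : w'.length ≤ (List.replicate n true ++ w').length := by simp
    generalize (List.replicate n true ++ w').length = N at hn hw
    have h1 := Polynomial.eval_le_eval P.cost hn
    have h2 : n ^ 2 ≤ N ^ 2 := by gcongr
    simp only [Polynomial.eval_add, Polynomial.eval_mul, Polynomial.eval_pow, Polynomial.eval_X,
      Polynomial.eval_ofNat]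
    omega
  refine ⟨⟨⟨machine (Γ := Alphabet) Stack.inp initialCtrl (decider P acc), Equiv.refl _, Equiv.refl _⟩,
    P.cost + (13 * Polynomial.X ^ 2 + 14 * Polynomial.X + 2 * Polynomial.X + 17), fun w => ?_⟩⟩
  have hid (l : List Bool) : l.map id = l := List.map_id l
  have h := Classical.choice (main w)
  change Turing.TM2OutputsInTime (machine (Γ := Alphabet) Stack.inp initialCtrl (decider P acc))
    (List.map id w) (some (List.map id [decide (w ∈ L)])) _
  erw [hid, hid]
  exact h

end GridMachine

namespace GridMachine

open Function

namespace Prog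

/-- A decision procedure for `WellFormed`. -/
def decidableWellFormed : (P : Prog) → Decidable P.WellFormed
  | get _ _ _ _ => .isTrue trivial
  | put _ _ _ _ => .isTrue trivial
  | load _ => .isTrue trivial
  | read _ => .isTrue trivial
  | seq c d =>
    have := decidableWellFormed c
    have := decidableWellFormed d
    inferInstanceAs (Decidable (_ ∧ _ ∧ _))
  | forEach _ c =>
    have := decidableWellFormed c
    inferInstanceAs (Decidable (_ ∧ _ ∧ _))

instance (P : Prog) : Decidable P.WellFormed := decidableWellFormed P

end Prog

/-! ### First-order formulas -/

/-- First-order formulas over the tables. -/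
inductive Formula
  | atom (j : TabIdx) (a b : VarIdx)
  | neg (φ : Formula)
  | conj (φ ψ : Formula)
  | ex (a : VarIdx) (φ : Formula)

/-- The register with the given number. -/
def regIdx (d : ℕ) : RegIdx := Fin.ofNat 8 d

theorem regIdx_val {d : ℕ} (h : d < 8) : (regIdx d).val = d := Nat.mod_eq_of_lt h

theorem ne_regIdx {d : ℕ} (h : d < 8) {k : RegIdx} (hk : k.val ≠ d) : k ≠ regIdx d := by
  rintro rfl
  exact hk (regIdx_val h)

namespace Formula

/-- Disjunction. -/
def disj (φ ψ : Formula) : Formula := neg (conj (neg φ) (neg ψ))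

/-- Implication. -/
def imp (φ ψ : Formula) : Formula := neg (conj φ (neg ψ))

/-- Universal quantification. -/
def all (a : VarIdx) (φ : Formula) : Formula := neg (ex a (neg φ))

/-- Truth of a formula over the vertices `0, …, n - 1`. -/
def Holds (n : ℕ) (R : Tables) : Formula → Env → Prop
  | atom j a b, e => e a < n ∧ e b < n ∧ R j (e a) (e b) = true
  | neg φ, e => ¬ φ.Holds n R e
  | conj φ ψ, e => φ.Holds n R e ∧ ψ.Holds n R e
  | ex a φ, e => ∃ i < n, φ.Holds n R (update e a i)

theorem holds_disj (n : ℕ) (R : Tables) (φ ψ : Formula) (e : Env) :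
    (disj φ ψ).Holds n R e ↔ φ.Holds n R e ∨ ψ.Holds n R e := by
  simp only [disj, Holds]
  tauto

theorem holds_imp (n : ℕ) (R : Tables) (φ ψ : Formula) (e : Env) :
    (imp φ ψ).Holds n R e ↔ (φ.Holds n R e → ψ.Holds n R e) := by
  simp only [imp, Holds]
  tauto

theorem holds_all (n : ℕ) (R : Tables) (a : VarIdx) (φ : Formula) (e : Env) :
    (all a φ).Holds n R e ↔ ∀ i < n, φ.Holds n R (update e a i) := by
  simp [all, Holds]

/-- Whether a table does not occur in a formula. -/
def Avoids (j : TabIdx) : Formula → Prop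
  | atom j' _ _ => j' ≠ j
  | neg φ => φ.Avoids j
  | conj φ ψ => φ.Avoids j ∧ ψ.Avoids j
  | ex _ φ => φ.Avoids j

theorem holds_congr {n : ℕ} {R R' : Tables} {j : TabIdx} (h : ∀ j' ≠ j, R j' = R' j')
    {φ : Formula} (hφ : φ.Avoids j) (e : Env) : φ.Holds n R e ↔ φ.Holds n R' e := by
  induction φ generalizing e with
  | atom j' a b => simp [Holds, h j' hφ]
  | neg φ ih => simp [Holds, ih hφ]
  | conj φ ψ ih ih' => simp [Holds, ih hφ.1, ih' hφ.2]
  | ex a φ ih => simp [Holds, ih hφ]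

/-- The number of additional registers that the evaluation of a formula uses. -/
def depth : Formula → ℕ
  | atom _ _ _ => 0
  | neg φ => φ.depth
  | conj φ ψ => max φ.depth (ψ.depth + 1)
  | ex _ φ => φ.depth + 1

/-- The program that evaluates a formula into register `d`, and uses the registers from `d` on. -/
def toProg : Formula → ℕ → Prog
  | atom j a b, d => .seq (.load fun r => update r (regIdx d) false) (.get j a b (regIdx d))
  | neg φ, d => .seq (φ.toProg d) (.load fun r => update r (regIdx d) (!r (regIdx d)))
  | conj φ ψ, d => .seq (φ.toProg d) (.seq (ψ.toProg (d + 1))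
      (.load fun r => update r (regIdx d) (r (regIdx d) && r (regIdx (d + 1)))))
  | ex a φ, d => .seq (.load fun r => update r (regIdx d) false)
      (.forEach a (.seq (φ.toProg (d + 1))
        (.load fun r => update r (regIdx d) (r (regIdx d) || r (regIdx (d + 1))))))

end Formula

theorem foldl_range_induction {α : Type*} (f : α → ℕ → α) (P : ℕ → α → Prop) (n : ℕ) (s : α)
    (h0 : P 0 s) (hs : ∀ i < n, ∀ s, P i s → P (i + 1) (f s i)) :
    P n ((List.range n).foldl f s) := by
  induction n with
  | zero => exact h0
  | succ n ih =>
    rw [List.range_succ, List.foldl_append]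
    exact hs n (Nat.lt_succ_self n) _ (ih fun i hi => hs i (hi.trans (Nat.lt_succ_self n)))

/-- Preservation of the registers below `d` makes the induction work: a partial result waits in
register `d` while a subformula is evaluated from `d + 1` on. -/
theorem Formula.eval_toProg (φ : Formula) (n : ℕ) (d : ℕ) (hd : d + φ.depth < 8) (e : Env)
    (s : State) : ∃ r, (φ.toProg d).eval n e s = { s with reg := r } ∧
      (r (regIdx d) = true ↔ φ.Holds n s.tab e) ∧ ∀ k : RegIdx, k.val < d → r k = s.reg k := by
  induction φ generalizing d e s with
  | atom j a b =>
    have hd' : d < 8 := by simpa [depth] using hd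
    refine ⟨_, rfl, ?_, fun k hk => ?_⟩
    · simp only [Holds, Prog.eval]
      split_ifs with h
      · simp [h.1, h.2]
      · simp only [update_self, Bool.false_eq_true, false_iff]
        tauto
    · have := ne_regIdx hd' hk.ne
      split_ifs <;> simp [this, Prog.eval]
  | neg φ ih =>
    have hd' : d < 8 := by simp only [depth] at hd; omega
    obtain ⟨r, hr, h, hk⟩ := ih d hd e s
    refine ⟨update r (regIdx d) (!r (regIdx d)), by simp only [toProg, Prog.eval, hr], ?_,
      fun k hkd => ?_⟩
    · simp [Holds, ← h]
    · rw [update_of_ne (ne_regIdx hd' hkd.ne), hk k hkd]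
  | conj φ ψ ih ih' =>
    simp only [depth] at hd
    have hd' : d < 8 := by omega
    obtain ⟨r, hr, h, hk⟩ := ih d (by omega) e s
    obtain ⟨r', hr', h', hk'⟩ := ih' (d + 1) (by omega) e { s with reg := r }
    refine ⟨update r' (regIdx d) (r' (regIdx d) && r' (regIdx (d + 1))),
      by simp only [toProg, Prog.eval, hr, hr'], ?_, fun k hkd => ?_⟩
    · simp [Holds, ← h, ← h', hk' (regIdx d) (by rw [regIdx_val hd']; omega)]
    · rw [update_of_ne (ne_regIdx hd' hkd.ne), hk' k (by omega)]; exact hk k hkd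
  | ex a φ ih =>
    simp only [depth] at hd
    have hd' : d < 8 := by omega
    simp only [toProg, Prog.eval]
    set s₀ : State := { s with reg := update s.reg (regIdx d) false } with hs₀
    set f := fun (s : State) i => (⟨update (Prog.eval n (φ.toProg (d + 1)) (update e a i) s).reg
      (regIdx d) ((Prog.eval n (φ.toProg (d + 1)) (update e a i) s).reg (regIdx d) ||
        (Prog.eval n (φ.toProg (d + 1)) (update e a i) s).reg (regIdx (d + 1))),
      (Prog.eval n (φ.toProg (d + 1)) (update e a i) s).inp,
      (Prog.eval n (φ.toProg (d + 1)) (update e a i) s).tab⟩ : State) with hf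
    have key := foldl_range_induction f (fun m s' => ∃ r, s' = { s with reg := r } ∧
      (r (regIdx d) = true ↔ ∃ i < m, φ.Holds n s.tab (update e a i)) ∧
      ∀ k : RegIdx, k.val < d → r k = s.reg k) n s₀
      ⟨_, rfl, by simp, fun k hkd => update_of_ne (ne_regIdx hd' hkd.ne) ..⟩ ?_
    · exact key
    · rintro m - _ ⟨r, rfl, h, hk⟩
      obtain ⟨r', hr', h', hk'⟩ := ih (d + 1) (by omega) (update e a m) { s with reg := r }
      refine ⟨update r' (regIdx d) (r' (regIdx d) || r' (regIdx (d + 1))),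
        by simp only [hf, hr'], ?_, fun k hkd => ?_⟩
      · simp only [update_self, Bool.or_eq_true, h', hk' (regIdx d) (by rw [regIdx_val hd']; omega),
          h, Nat.lt_succ_iff_lt_or_eq]
        constructor
        · rintro (⟨i, hi, hφ⟩ | hφ)
          · exact ⟨i, .inl hi, hφ⟩
          · exact ⟨m, .inr rfl, hφ⟩
        · rintro ⟨i, hi | rfl, hφ⟩
          · exact .inl ⟨i, hi, hφ⟩
          · exact .inr hφ
      · rw [update_of_ne (ne_regIdx hd' hkd.ne), hk' k (by omega)]; exact hk k hkd

/-! ### Assignments and iterations -/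

/-- The state `s'` arises from `s` by setting table `j` to the relation `Q`. Registers may change,
except for the first one. -/
structure Updates (n : ℕ) (j : TabIdx) (Q : ℕ → ℕ → Prop) (s s' : State) : Prop where
  inp : s'.inp = s.inp
  reg_zero : s'.reg 0 = s.reg 0
  tab_of_ne : ∀ j', j' ≠ j → s'.tab j' = s.tab j'
  tab_iff : ∀ u < n, ∀ w < n, (s'.tab j u w = true ↔ Q u w)

/-- The program that assigns to table `j` the relation that is defined by `φ` in the variables
`0` and `1`. -/
def assign (j : TabIdx) (φ : Formula) : Prog :=
  .forEach 0 (.forEach 1 (.seq (φ.toProg 1) (.put j 0 1 1)))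

/-- An environment with given values of the variables `0` and `1`. -/
abbrev pairEnv (e : Env) (u w : ℕ) : Env := update (update e 0 u) 1 w

/-- Because `φ` does not mention table `j`, the entries already overwritten do not affect later
evaluations. Registers are used from `1` on, which spares the error bit in register `0`. -/
theorem updates_assign (n : ℕ) (j : TabIdx) (φ : Formula) (hj : φ.Avoids j)
    (hd : φ.depth < 7) (e : Env) (s : State) :
    Updates n j (fun u w => φ.Holds n s.tab (pairEnv e u w)) s ((assign j φ).eval n e s) := by
  let P : (ℕ → ℕ → Prop) → State → Prop := fun D s' => s'.inp = s.inp ∧ s'.reg 0 = s.reg 0 ∧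
    (∀ j', j' ≠ j → s'.tab j' = s.tab j') ∧
    ∀ u w, D u w → (s'.tab j u w = true ↔ φ.Holds n s.tab (pairEnv e u w))
  have outer : P (fun u w => u < n ∧ w < n) ((assign j φ).eval n e s) := by
    refine foldl_range_induction _ (fun i => P fun u w => u < i ∧ w < n) n s
      ⟨rfl, rfl, fun _ _ => rfl, by simp⟩ ?_
    intro i _ s₁ hs₁
    have inner := foldl_range_induction (fun (s : State) k =>
        (Prog.seq (φ.toProg 1) (.put j 0 1 1)).eval n (pairEnv e i k) s)
      (fun k => P fun u w => u < i ∧ w < n ∨ u = i ∧ w < k) n s₁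
      (by simpa using hs₁) ?_
    · refine ⟨inner.1, inner.2.1, inner.2.2.1, fun u w huw => inner.2.2.2 u w ?_⟩
      dsimp only at huw ⊢
      omega
    · rintro k - s₂ ⟨h1, h2, h3, h4⟩
      obtain ⟨r, hr, hh, hk⟩ := φ.eval_toProg n 1 (by omega) (pairEnv e i k) s₂
      rw [Formula.holds_congr h3 hj] at hh
      have h0 : pairEnv e i k 0 = i := by simp [pairEnv]
      have h1' : pairEnv e i k 1 = k := by simp [pairEnv]
      simp only [Prog.eval, hr, h0, h1']
      refine ⟨h1, (hk 0 (by simp)).trans h2, fun j' hj' => ?_, fun u w huw => ?_⟩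
      · rw [← h3 j' hj']
        funext u w
        simp [setEntry, hj']
      · simp only [setEntry, true_and]
        split_ifs with h
        · obtain ⟨rfl, rfl⟩ := h
          exact hh
        · exact h4 u w (by omega)
  exact ⟨outer.1, outer.2.1, outer.2.2.1, fun u hu w hw => outer.2.2.2 u w ⟨hu, hw⟩⟩

/-- The program that replaces table `j` repeatedly, as often as there are vertices, by the relation
that is defined by `φ`. It uses table `7` to store intermediate results. -/
def iterate (j : TabIdx) (φ : Formula) : Prog :=
  .forEach 4 (.seq (assign 7 φ) (assign j (.atom 7 0 1)))

/-- `X i` is the intended relation after `i` rounds. As `φ` may read table `j`, each round is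
computed in table `7` and then copied, so that all entries change simultaneously. -/
theorem updates_iterate (n : ℕ) (j : TabIdx) (φ : Formula) (hj : j ≠ 7) (hφ : φ.Avoids 7)
    (hd : φ.depth < 7) (e : Env) (s : State) (X : ℕ → ℕ → ℕ → Prop)
    (h0 : ∀ u < n, ∀ w < n, (s.tab j u w = true ↔ X 0 u w))
    (hX : ∀ (i : ℕ) (R : Tables) (e : Env), (∀ j', j' ≠ 7 → j' ≠ j → R j' = s.tab j') →
      (∀ u < n, ∀ w < n, (R j u w = true ↔ X i u w)) →
      ∀ u < n, ∀ w < n, (φ.Holds n R (pairEnv e u w) ↔ X (i + 1) u w)) :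
    ∃ s', (iterate j φ).eval n e s = s' ∧ s'.inp = s.inp ∧ s'.reg 0 = s.reg 0 ∧
      (∀ j', j' ≠ 7 → j' ≠ j → s'.tab j' = s.tab j') ∧
      ∀ u < n, ∀ w < n, (s'.tab j u w = true ↔ X n u w) := by
  refine ⟨_, rfl, foldl_range_induction _ (fun i s' => s'.inp = s.inp ∧ s'.reg 0 = s.reg 0 ∧
    (∀ j', j' ≠ 7 → j' ≠ j → s'.tab j' = s.tab j') ∧
    ∀ u < n, ∀ w < n, (s'.tab j u w = true ↔ X i u w)) n s ⟨rfl, rfl, fun _ _ _ => rfl, h0⟩ ?_⟩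
  rintro i - s₁ ⟨h1, h2, h3, h4⟩
  have ha := updates_assign n 7 φ hφ hd (update e 4 i) s₁
  have hb := updates_assign n j (.atom 7 0 1) hj.symm (by simp [Formula.depth]) (update e 4 i)
    ((assign 7 φ).eval n (update e 4 i) s₁)
  refine ⟨hb.inp.trans (ha.inp.trans h1), hb.reg_zero.trans (ha.reg_zero.trans h2),
    fun j' hj₁ hj₂ => (hb.tab_of_ne j' hj₂).trans ((ha.tab_of_ne j' hj₁).trans (h3 j' hj₁ hj₂)),
    fun u hu w hw => ?_⟩
  refine (hb.tab_iff u hu w hw).trans ?_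
  simp only [Formula.Holds, pairEnv, update_self, ne_eq, Fin.isValue, zero_ne_one,
    not_false_eq_true, update_of_ne, hu, hw, true_and]
  rw [ha.tab_iff u hu w hw]
  exact hX i s₁.tab _ h3 h4 u hu w hw

/-! ### Reading the input -/

/-- The next input bit is stored in register `1`, and register `0` records whether the input
was too short. -/
def readBit (r : Reg) (o : Option Bool) : Reg :=
  update (update r 1 (o == some true)) 0 (r 0 || o.isNone)

/-- Reads the diagonal of a table from the input. -/
def readVector (j : TabIdx) : Prog := .forEach 0 (.seq (.read readBit) (.put j 0 0 1))

theorem eval_readVector (n : ℕ) (j : TabIdx) (e : Env) (s : State) :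
    ∃ s', (readVector j).eval n e s = s' ∧ s'.inp = s.inp.drop n ∧
      (s'.reg 0 = (s.reg 0 || decide (s.inp.length < n))) ∧
      (∀ j', j' ≠ j → s'.tab j' = s.tab j') ∧
      ∀ u < n, (s'.tab j u u = true ↔ s.inp[u]? = some true) := by
  refine ⟨_, rfl, foldl_range_induction _ (fun i s' => s'.inp = s.inp.drop i ∧
      (s'.reg 0 = (s.reg 0 || decide (s.inp.length < i))) ∧
      (∀ j', j' ≠ j → s'.tab j' = s.tab j') ∧
      ∀ u < i, (s'.tab j u u = true ↔ s.inp[u]? = some true)) n s (by simp) ?_⟩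
  rintro i - s₁ ⟨h1, h2, h3, h4⟩
  simp only [Prog.eval, h1, readBit, List.tail_drop, update_self, List.head?_drop]
  refine ⟨trivial, ?_, fun j' hj' => ?_, fun u hu => ?_⟩
  · rw [h2, Bool.or_assoc]
    congr 1
    rw [Bool.eq_iff_iff]
    simp
    omega
  · rw [← h3 j' hj']
    funext u w
    simp [setEntry, hj']
  · simp only [setEntry, true_and, and_self]
    split_ifs with h
    · subst h; simp
    · exact h4 u (by omega)

/-- Reads a table from the input. -/
def readMatrix (j : TabIdx) : Prog :=
  .forEach 0 (.forEach 1 (.seq (.read readBit) (.put j 0 1 1)))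

theorem eval_readMatrix (n : ℕ) (j : TabIdx) (e : Env) (s : State) :
    ∃ s', (readMatrix j).eval n e s = s' ∧ s'.inp = s.inp.drop (n * n) ∧
      (s'.reg 0 = (s.reg 0 || decide (s.inp.length < n * n))) ∧
      (∀ j', j' ≠ j → s'.tab j' = s.tab j') ∧
      ∀ u < n, ∀ w < n, (s'.tab j u w = true ↔ s.inp[u * n + w]? = some true) := by
  let P : ℕ → (ℕ → ℕ → Prop) → State → Prop := fun i D s' => s'.inp = s.inp.drop i ∧
      (s'.reg 0 = (s.reg 0 || decide (s.inp.length < i))) ∧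
      (∀ j', j' ≠ j → s'.tab j' = s.tab j') ∧
      ∀ u w, D u w → (s'.tab j u w = true ↔ s.inp[u * n + w]? = some true)
  have outer : P (n * n) (fun u w => u < n ∧ w < n) ((readMatrix j).eval n e s) := by
    refine foldl_range_induction _ (fun i => P (i * n) fun u w => u < i ∧ w < n) n s
      (by simp [P]) ?_
    intro i _ s₁ hs₁
    have inner := foldl_range_induction (fun (s : State) k =>
        (Prog.seq (.read readBit) (.put j 0 1 1)).eval n (pairEnv e i k) s)
      (fun k => P (i * n + k) fun u w => u < i ∧ w < n ∨ u = i ∧ w < k) n s₁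
      (by simpa using hs₁) ?_
    · rw [Nat.succ_mul]
      refine ⟨inner.1, inner.2.1, inner.2.2.1, fun u w huw => inner.2.2.2 u w ?_⟩
      dsimp only at huw ⊢
      omega
    · rintro k - s₂ ⟨h1, h2, h3, h4⟩
      have h0 : pairEnv e i k 0 = i := by simp [pairEnv]
      simp only [Prog.eval, h1, readBit, List.tail_drop, update_self, List.head?_drop, h0]
      refine ⟨rfl, ?_, fun j' hj' => ?_, fun u w huw => ?_⟩
      · simp only [update_self]
        rw [h2, Bool.or_assoc]
        congr 1
        rw [Bool.eq_iff_iff]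
        simp
        omega
      · rw [← h3 j' hj']
        funext u w
        simp [setEntry, hj']
      · simp only [setEntry, true_and]
        split_ifs with h
        · obtain ⟨rfl, rfl⟩ := h; simp
        · exact h4 u w (by omega)
  exact ⟨_, rfl, outer.1, outer.2.1, outer.2.2.1, fun u hu w hw => outer.2.2.2 u w ⟨hu, hw⟩⟩

/-- Sets the diagonal of a table. -/
def setDiagonal (j : TabIdx) : Prog :=
  .forEach 0 (.seq (.load fun r => update r 1 true) (.put j 0 0 1))

theorem updates_setDiagonal (n : ℕ) (j : TabIdx) (e : Env) (s : State)
    (hs : s.tab j = fun _ _ => false) :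
    Updates n j (fun u w => u = w) s ((setDiagonal j).eval n e s) := by
  have := foldl_range_induction (fun (s : State) k =>
        (Prog.seq (.load fun r => update r 1 true) (.put j 0 0 1)).eval n (update e 0 k) s)
    (fun i s' => s'.inp = s.inp ∧ s'.reg 0 = s.reg 0 ∧
      (∀ j', j' ≠ j → s'.tab j' = s.tab j') ∧
      ∀ u w, (s'.tab j u w = true ↔ u < i ∧ u = w)) n s (by simp [hs]) ?_
  · exact ⟨this.1, this.2.1, this.2.2.1, fun u hu w hw => (this.2.2.2 u w).trans (by simp [hu])⟩
  · rintro i - s₁ ⟨h1, h2, h3, h4⟩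
    simp only [Prog.eval, update_self]
    refine ⟨h1, by simp [h2], fun j' hj' => ?_, fun u w => ?_⟩
    · rw [← h3 j' hj']
      funext u w
      simp [setEntry, hj']
    · simp only [setEntry, true_and]
      split_ifs with h
      · simp; omega
      · rw [h4]; omega

end GridMachine

/-! ### Arenas in which every vertex of Adam has a successor -/

namespace GameArena

variable {V : Type*}

/-- The arena with a loop added to each vertex of Adam without successors. -/
def withLoops (A : GameArena V) : GameArena V where
  Edge u v := A.Edge u v ∨ u = v ∧ u ∉ A.eve ∧ ¬ ∃ w, A.Edge u w
  eve := A.eve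

variable {A : GameArena V}

theorem withLoops_succ_of_nonempty {u : V} (h : (A.succ u).Nonempty) :
    A.withLoops.succ u = A.succ u := by
  ext v
  exact or_iff_left fun h' => h'.2.2 h

theorem withLoops_succ_of_eve {u : V} (h : u ∈ A.eve) : A.withLoops.succ u = A.succ u := by
  ext v
  exact or_iff_left fun h' => h'.2.1 h

theorem withLoops_succ_nonempty {u : V} (h : u ∈ A.withLoops.adam) :
    (A.withLoops.succ u).Nonempty := by
  by_cases hs : (A.succ u).Nonempty
  · rwa [withLoops_succ_of_nonempty hs]
  · exact ⟨u, .inr ⟨rfl, h, hs⟩⟩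

/-- A move along an added loop leaves the vertex unchanged, and by `hv` also the visited set. -/
theorem win_withLoops_iff [Finite V] {𝓕 : Finset (Finset V)} {vis : Set V} {v : V} (hv : v ∈ vis) :
    A.withLoops.Win 𝓕 vis v ↔ A.Win 𝓕 vis v := by
  constructor
  · intro h
    refine Win.induction (P := fun vis v => v ∈ vis → A.Win 𝓕 vis v) ?_ ?_ ?_ h hv
    · exact fun vis v hd _ => .done hd
    · intro vis v hv u hu _ ih _
      exact .of_eve hv (withLoops_succ_of_eve (A := A) hv ▸ hu) (ih (Set.mem_insert _ _))
    · intro vis v hv hs' _ ih hvis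
      by_cases hs : (A.succ v).Nonempty
      · rw [withLoops_succ_of_nonempty hs] at ih
        exact .of_adam hv hs fun u hu => ih u hu (Set.mem_insert _ _)
      · have := ih v (.inr ⟨rfl, hv, hs⟩) (Set.mem_insert _ _)
        rwa [Set.insert_eq_of_mem hvis] at this
  · refine Win.induction (P := fun vis v => A.withLoops.Win 𝓕 vis v) ?_ ?_ ?_
    · exact fun vis v hd => .done hd
    · intro vis v hv u hu _ ih
      exact .of_eve hv (withLoops_succ_of_eve (A := A) hv ▸ hu) ih
    · intro vis v hv hs _ ih
      rw [← withLoops_succ_of_nonempty hs] at ih hs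
      exact .of_adam hv hs ih

end GameArena

namespace OneLargeTargetGame

/-- The game on the arena in which every vertex of Adam has a successor. -/
def withLoops {V : Type*} (G : OneLargeTargetGame V) : OneLargeTargetGame V :=
  { G with arena := G.arena.withLoops }

theorem eveWins_iff_criterion_withLoops {V : Type*} [Finite V] (G : OneLargeTargetGame V) :
    G.EveWins ↔ G.withLoops.Criterion := by
  rw [← eveWins_iff_criterion (G := G.withLoops) fun v hv =>
    GameArena.withLoops_succ_nonempty (A := G.arena) hv, eveWins_iff_win,
    eveWins_iff_win]
  exact (GameArena.win_withLoops_iff (A := G.arena) (Set.mem_singleton G.start)).symm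

end OneLargeTargetGame

/-! ### The decision procedure -/

namespace GridMachine

open Function Formula

theorem exists_lt_iff_fin {n : ℕ} {p : ℕ → Prop} : (∃ i < n, p i) ↔ ∃ i : Fin n, p i :=
  ⟨fun ⟨i, hi, h⟩ => ⟨⟨i, hi⟩, h⟩, fun ⟨i, h⟩ => ⟨i, i.2, h⟩⟩

theorem forall_lt_iff_fin {n : ℕ} {p : ℕ → Prop} : (∀ i < n, p i) ↔ ∀ i : Fin n, p i :=
  ⟨fun h i => h i i.2, fun h i hi => h ⟨i, hi⟩⟩

/-- The edge relation with loops at the vertices of Adam without successors. The tables are: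
`0` Eve's vertices, `1` the start vertex, `2` the large target set, `3` the other targets, `4` the
edges, `5` the attractors of the singletons, `6` the attractors of the useful targets,
`8` equality, `9` the edges with loops. Sets are stored on the diagonal. -/
def edgeFormula : Formula :=
  disj (atom 4 0 1) (conj (atom 8 0 1) (conj (neg (atom 0 0 0)) (neg (ex 2 (atom 4 0 2)))))

/-- One step of the computation of attractors. -/
def attrFormula (j : TabIdx) : Formula :=
  disj (disj (atom j 0 1) (conj (atom 0 0 0) (ex 2 (conj (atom 9 0 2) (atom j 2 1)))))
    (conj (neg (atom 0 0 0)) (all 2 (imp (atom 9 0 2) (atom j 2 1))))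

/-- The useful targets. -/
def usefulFormula : Formula :=
  conj (atom 2 0 0) (all 2 (imp (atom 3 2 2) (disj (atom 5 2 1) (atom 5 0 2))))

/-- The large target set has more than one element, and there is exactly one start vertex. -/
def validFormula : Formula :=
  conj (conj (ex 0 (ex 1 (conj (conj (atom 2 0 0) (atom 2 1 1)) (neg (atom 8 0 1)))))
    (ex 0 (atom 1 0 0)))
    (all 0 (all 1 (imp (conj (atom 1 0 0) (atom 1 1 1)) (atom 8 0 1))))

/-- The criterion for Eve to win. -/
def criterionFormula : Formula :=
  conj (conj
    (all 0 (all 1 (imp (conj (atom 3 0 0) (atom 3 1 1)) (disj (atom 5 0 1) (atom 5 1 0)))))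
    (all 0 (all 1 (imp (conj (atom 1 0 0) (atom 3 1 1)) (atom 5 0 1)))))
    (ex 0 (conj (disj (atom 3 0 0) (atom 1 0 0)) (atom 6 0 0)))

/-- Register `0` records whether there is unread input. -/
def readEnd : Prog := .read fun r o => update r 0 (r 0 || o.isSome)

/-- The part of the program that reads the game. -/
def readGame : Prog :=
  .seq (readVector 0) (.seq (readVector 1) (.seq (readVector 2) (.seq (readVector 3)
    (.seq (readMatrix 4) readEnd))))

/-- The part of the program that solves the game. -/
def solveGame : Prog :=
  .seq (setDiagonal 8) (.seq (assign 9 edgeFormula)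
    (.seq (assign 5 (atom 8 0 1)) (.seq (iterate 5 (attrFormula 5))
      (.seq (assign 6 usefulFormula) (.seq (iterate 6 (attrFormula 6))
        ((conj validFormula criterionFormula).toProg 1))))))

theorem wellFormed_program : (Prog.seq readGame solveGame).WellFormed := by decide

theorem free_program : ∀ x, (Prog.seq readGame solveGame).free x = false := by decide

/-- Column `w` of the table holds the set `S w`, so attractors of `n` sets are computed at once. By
`attr_eq_attrStep`, `n` rounds suffice. -/
theorem iterate_attrFormula {n : ℕ} (A : GameArena (Fin n)) (S : Fin n → Set (Fin n))
    {j : TabIdx} (hj : j ≠ 7) (hj₀ : j ≠ 0) (hj₉ : j ≠ 9) (e : Env) (s : State)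
    (heve : ∀ v : Fin n, s.tab 0 v v = true ↔ v ∈ A.eve)
    (hE : ∀ u v : Fin n, s.tab 9 u v = true ↔ A.Edge u v)
    (hS : ∀ u w : Fin n, s.tab j u w = true ↔ u ∈ S w) :
    ∃ s', (iterate j (attrFormula j)).eval n e s = s' ∧ s'.inp = s.inp ∧ s'.reg 0 = s.reg 0 ∧
      (∀ j', j' ≠ 7 → j' ≠ j → s'.tab j' = s.tab j') ∧
      ∀ u w : Fin n, s'.tab j u w = true ↔ u ∈ A.attr (S w) := by
  obtain ⟨s', h1, h2, h3, h4, h5⟩ := updates_iterate n j (attrFormula j) hj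
    (by simp [attrFormula, disj, all, imp, Avoids, hj]) (by simp [attrFormula, disj, all, imp, depth])
    e s (fun i u w => ∃ (hu : u < n) (hw : w < n), (⟨u, hu⟩ : Fin n) ∈ A.attrStep (S ⟨w, hw⟩) i)
    (fun u hu w hw => by simpa [hu, hw, GameArena.attrStep] using hS ⟨u, hu⟩ ⟨w, hw⟩)
    (fun i R e hR hX u hu w hw => by
      obtain ⟨u, rfl⟩ : ∃ u' : Fin n, ↑u' = u := ⟨⟨u, hu⟩, rfl⟩
      obtain ⟨w, rfl⟩ : ∃ w' : Fin n, ↑w' = w := ⟨⟨w, hw⟩, rfl⟩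
      have h0 := hR 0 (by decide) hj₀.symm
      have h9 := hR 9 (by decide) hj₉.symm
      have hX' : ∀ u w : Fin n, R j u w = true ↔ u ∈ A.attrStep (S w) i := fun u w => by
        simpa using hX u u.2 w w.2
      simp [attrFormula, holds_disj, holds_all, holds_imp, Holds, exists_lt_iff_fin, pairEnv,
        forall_lt_iff_fin, h0, h9, heve, hE, hX', GameArena.attrStep,
        GameArena.adam, GameArena.succ])
  refine ⟨s', h1, h2, h3, h4, fun u w => ?_⟩
  rw [h5 u u.2 w w.2, A.attr_eq_attrStep, Nat.card_eq_fintype_card, Fintype.card_fin]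
  simp

/-- The tables `0` to `4` represent the given set of Eve's vertices, set of start vertices,
target sets, and edges. -/
structure Represents {n : ℕ} (R : Tables) (A : GameArena (Fin n)) (S : Set (Fin n))
    (F T : Finset (Fin n)) : Prop where
  eve : ∀ v : Fin n, R 0 v v = true ↔ v ∈ A.eve
  start : ∀ v : Fin n, R 1 v v = true ↔ v ∈ S
  large : ∀ v : Fin n, R 2 v v = true ↔ v ∈ F
  singles : ∀ v : Fin n, R 3 v v = true ↔ v ∈ T
  edge : ∀ u v : Fin n, R 4 u v = true ↔ A.Edge u v

/-- The input is not assumed to be valid: `S` is an arbitrary set of start vertices, and the first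
conjunct is the validity check. The others are `Criterion` for the arena with loops. -/
theorem eval_solveGame {n : ℕ} (e : Env) (s : State) {A : GameArena (Fin n)} {S : Set (Fin n)}
    {F T : Finset (Fin n)} (hs : Represents s.tab A S F T) (h8 : s.tab 8 = fun _ _ => false) :
    (solveGame.eval n e s).reg 0 = s.reg 0 ∧ ((solveGame.eval n e s).reg 1 = true ↔
      ((∃ x ∈ F, ∃ y ∈ F, x ≠ y) ∧ (∃ x, x ∈ S) ∧ ∀ x ∈ S, ∀ y ∈ S, x = y) ∧
      (∀ t ∈ T, ∀ t' ∈ T, t ∈ A.withLoops.attr {t'} ∨ t' ∈ A.withLoops.attr {t}) ∧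
      (∀ x ∈ S, ∀ t ∈ T, x ∈ A.withLoops.attr {t}) ∧
      ∃ u, (u ∈ T ∨ u ∈ S) ∧ u ∈ A.withLoops.attr
        {f | f ∈ F ∧ ∀ t ∈ T, t ∈ A.withLoops.attr {u} ∨ f ∈ A.withLoops.attr {t}}) := by
  have u₁ := updates_setDiagonal n 8 e s h8
  set s₁ := (setDiagonal 8).eval n e s with hs₁
  have u₂ := updates_assign n 9 edgeFormula (by simp [edgeFormula, disj, Avoids])
    (by simp [edgeFormula, disj, depth]) e s₁
  set s₂ := (assign 9 edgeFormula).eval n e s₁ with hs₂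
  have u₃ := updates_assign n 5 (atom 8 0 1) (by simp [Avoids]) (by simp [depth]) e s₂
  set s₃ := (assign 5 (atom 8 0 1)).eval n e s₂ with hs₃
  have lift {j : TabIdx} {Q : ℕ → ℕ → Prop} {s s' : State} (h : Updates n j Q s s') (u w : Fin n) :
      s'.tab j u w = true ↔ Q u w := h.tab_iff u u.2 w w.2
  have heq₁ : ∀ u w : Fin n, s₁.tab 8 u w = true ↔ u = w := fun u w => by
    rw [lift u₁, Fin.ext_iff]
  have hE : ∀ u w : Fin n, s₂.tab 9 u w = true ↔ A.withLoops.Edge u w := fun u w => by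
    rw [lift u₂]
    simp [edgeFormula, holds_disj, Holds, exists_lt_iff_fin, heq₁,
      u₁.tab_of_ne, hs.eve, hs.edge, GameArena.withLoops]
  have hM₀ : ∀ u w : Fin n, s₃.tab 5 u w = true ↔ u ∈ ({w} : Set (Fin n)) := fun u w => by
    rw [lift u₃]
    simp [Holds, u₂.tab_of_ne, heq₁]
  obtain ⟨s₄, hs₄, -, hr₄, ht₄, hM⟩ := iterate_attrFormula A.withLoops (fun w => {w})
    (j := 5) (by decide) (by decide) (by decide) e s₃
    (fun v => by simp [u₃.tab_of_ne, u₂.tab_of_ne, u₁.tab_of_ne, hs.eve, GameArena.withLoops])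
    (fun u v => by simp [u₃.tab_of_ne, hE]) hM₀
  have u₅ := updates_assign n 6 usefulFormula
    (by simp [usefulFormula, disj, all, imp, Avoids])
    (by simp [usefulFormula, disj, all, imp, depth]) e s₄
  set s₅ := (assign 6 usefulFormula).eval n e s₄ with hs₅
  have ht₅ : ∀ j, j ≠ 5 → j ≠ 6 → j ≠ 7 → j ≠ 8 → j ≠ 9 → s₅.tab j = s.tab j :=
    fun j h5 h6 h7 h8 h9 => by
      rw [u₅.tab_of_ne j h6, ht₄ j h7 h5, u₃.tab_of_ne j h5, u₂.tab_of_ne j h9, u₁.tab_of_ne j h8]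
  have hY₀ : ∀ u w : Fin n, s₅.tab 6 u w = true ↔
      u ∈ {f | f ∈ F ∧ ∀ t ∈ T, t ∈ A.withLoops.attr {w} ∨ f ∈ A.withLoops.attr {t}} :=
    fun u w => by
      rw [lift u₅]
      simp [usefulFormula, holds_disj, holds_all, holds_imp, Holds, forall_lt_iff_fin,
        hM, ht₄, u₃.tab_of_ne, u₂.tab_of_ne, u₁.tab_of_ne, hs.large, hs.singles]
  obtain ⟨s₆, hs₆, -, hr₆, ht₆, hY⟩ := iterate_attrFormula A.withLoops
    (fun w => {f | f ∈ F ∧ ∀ t ∈ T, t ∈ A.withLoops.attr {w} ∨ f ∈ A.withLoops.attr {t}})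
    (j := 6) (by decide) (by decide) (by decide) e s₅
    (fun v => by simp [ht₅, hs.eve, GameArena.withLoops])
    (fun u v => by simp [u₅.tab_of_ne, ht₄, u₃.tab_of_ne, hE]) hY₀
  have hM₆ : ∀ u w : Fin n, s₆.tab 5 u w = true ↔ u ∈ A.withLoops.attr {w} := fun u w => by
    simp [ht₆, u₅.tab_of_ne, hM]
  have heq₆ : ∀ u w : Fin n, s₆.tab 8 u w = true ↔ u = w := fun u w => by
    simp [ht₆, u₅.tab_of_ne, ht₄, u₃.tab_of_ne, u₂.tab_of_ne, heq₁]
  have ht : ∀ j, j ≠ 5 → j ≠ 6 → j ≠ 7 → j ≠ 8 → j ≠ 9 → s₆.tab j = s.tab j :=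
    fun j h5 h6 h7 h8 h9 => by rw [ht₆ j h7 h6, ht₅ j h5 h6 h7 h8 h9]
  obtain ⟨r, hr, hr₁, hr₀⟩ := (conj validFormula criterionFormula).eval_toProg n 1
    (by simp [validFormula, criterionFormula, disj, all, imp, depth]) e s₆
  have hfinal : solveGame.eval n e s = { s₆ with reg := r } := by
    rw [← hr, ← hs₆, hs₅, ← hs₄]
    rfl
  rw [hfinal]
  refine ⟨?_, ?_⟩
  · rw [← u₁.reg_zero, ← u₂.reg_zero, ← u₃.reg_zero, ← hr₄, ← u₅.reg_zero, ← hr₆]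
    exact hr₀ 0 (by simp)
  · refine Iff.trans hr₁ ?_
    simp [-Bool.not_eq_true, validFormula, criterionFormula, holds_disj, holds_all, holds_imp, Holds,
      forall_lt_iff_fin, exists_lt_iff_fin, ht, hM₆, heq₆, hY, hs.large, hs.start,
      hs.singles]
    constructor
    · rintro ⟨⟨⟨⟨x, y, ⟨hx, hy⟩, hxy⟩, hS⟩, huniq⟩, ⟨hc, hst⟩, hreach⟩
      exact ⟨⟨⟨x, hx, y, hy, hxy⟩, hS, fun x hx y hy => huniq x y hx hy⟩,
        fun t ht t' ht' => hc t t' ht ht', fun x hx t ht => hst x t hx ht, hreach⟩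
    · rintro ⟨⟨⟨x, hx, y, hy, hxy⟩, hS, huniq⟩, hc, hst, hreach⟩
      exact ⟨⟨⟨⟨x, y, ⟨hx, hy⟩, hxy⟩, hS⟩, fun x y hx hy => huniq x hx y hy⟩,
        ⟨fun t t' ht ht' => hc t ht t' ht', fun x t hx ht => hst x hx t ht⟩, hreach⟩

end GridMachine

/-! ### Reading games -/

theorem List.ofFn_decide_append_eq_iff {n : ℕ} (p : Fin n → Prop) [DecidablePred p]
    (l l' : List Bool) : List.ofFn (fun v => decide (p v)) ++ l' = l ↔
      n ≤ l.length ∧ (∀ v : Fin n, l[(v : ℕ)]? = some true ↔ p v) ∧ l' = l.drop n := by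
  constructor
  · rintro rfl
    refine ⟨by simp, fun v => ?_, ?_⟩
    · rw [List.getElem?_append_left (by simp)]
      simp
    · rw [List.drop_append_of_le_length (by simp)]
      simp
  · rintro ⟨hl, hp, rfl⟩
    conv_rhs => rw [← List.take_append_drop n l]
    congr 1
    refine List.ext_getElem (by simpa using hl) fun i h₁ h₂ => ?_
    have hi : i < n := by simpa using h₁
    rw [List.getElem_ofFn, List.getElem_take, Bool.eq_iff_iff, decide_eq_true_iff, ← hp]
    simp [List.getElem?_eq_getElem (show i < l.length by omega)]

theorem List.flatten_ofFn_decide_eq_iff {n : ℕ} (p : Fin n → Fin n → Prop)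
    [∀ u v, Decidable (p u v)] (l : List Bool) :
    (List.ofFn fun u => List.ofFn fun v => decide (p u v)).flatten = l ↔
      n * n ≤ l.length ∧ (∀ u v : Fin n, l[(u * n + v : ℕ)]? = some true ↔ p u v) ∧
        [] = l.drop (n * n) := by
  have h := List.ofFn_decide_append_eq_iff (n := n * n) (fun k => p k.divNat k.modNat) l []
  rw [List.append_nil, List.ofFn_mul] at h
  have hdiv (u v : Fin n) (hk : (u * n + v : ℕ) < n * n) :
      (⟨u * n + v, hk⟩ : Fin (n * n)).divNat = u ∧ (⟨u * n + v, hk⟩ : Fin (n * n)).modNat = v := by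
    have hn : 0 < n := u.pos
    constructor
    · ext
      simp only [Fin.divNat]
      rw [Nat.add_comm, Nat.add_mul_div_right _ _ hn, Nat.div_eq_of_lt v.2, Nat.zero_add]
    · ext
      simp only [Fin.modNat]
      rw [Nat.add_comm, Nat.add_mul_mod_self_right, Nat.mod_eq_of_lt v.2]
  simp only [hdiv] at h
  rw [h]
  refine and_congr_right fun _ => and_congr_left fun _ => ⟨fun h u v => ?_, fun h k => ?_⟩
  -- Row-major positions `u * n + v` run through all indices below `n * n`.
  · have hk : (u * n + v : ℕ) < n * n := by nlinarith [u.2, v.2]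
    simpa [hdiv u v hk] using h ⟨u * n + v, hk⟩
  · have := h k.divNat k.modNat
    have hk : (k : ℕ) / n * n + (k : ℕ) % n = k := Nat.div_add_mod' _ _
    rwa [Fin.coe_divNat, Fin.coe_modNat, hk] at this

theorem List.replicate_append_eq_iff {n m : ℕ} {w l : List Bool} (hw : w.head? ≠ some true) :
    List.replicate m true ++ false :: l = List.replicate n true ++ w ↔ m = n ∧ w = false :: l := by
  constructor
  · intro h
    induction n generalizing m with
    | zero =>
      cases m with
      | zero => exact ⟨rfl, by simpa using h.symm⟩
      | succ m =>
        rw [List.replicate_zero, List.nil_append] at h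
        simp [← h, List.replicate_succ] at hw
    | succ n ih =>
      cases m with
      | zero => simp [List.replicate_succ] at h
      | succ m =>
        simp only [List.replicate_succ, List.cons_append, List.cons.injEq, true_and] at h
        exact ⟨congrArg _ (ih h).1, (ih h).2⟩
  · rintro ⟨rfl, rfl⟩
    rfl

namespace GridMachine

/-- Register `0` detects a missing bit during reading and a surplus bit at the end; the correct
length is four vectors and one matrix. -/
theorem eval_readGame (n : ℕ) (e : Env) (s : State) :
    ∃ s', readGame.eval n e s = s' ∧
      (s'.reg 0 = false ↔ s.reg 0 = false ∧ s.inp.length = 4 * n + n * n) ∧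
      s'.tab 8 = s.tab 8 ∧
      (∀ v < n, s'.tab 0 v v = true ↔ s.inp[v]? = some true) ∧
      (∀ v < n, s'.tab 1 v v = true ↔ (s.inp.drop n)[v]? = some true) ∧
      (∀ v < n, s'.tab 2 v v = true ↔ ((s.inp.drop n).drop n)[v]? = some true) ∧
      (∀ v < n, s'.tab 3 v v = true ↔ (((s.inp.drop n).drop n).drop n)[v]? = some true) ∧
      ∀ u < n, ∀ v < n, s'.tab 4 u v = true ↔
        ((((s.inp.drop n).drop n).drop n).drop n)[u * n + v]? = some true := by
  obtain ⟨s₁, h₁, i₁, r₁, t₁, d₁⟩ := eval_readVector n 0 e s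
  obtain ⟨s₂, h₂, i₂, r₂, t₂, d₂⟩ := eval_readVector n 1 e s₁
  obtain ⟨s₃, h₃, i₃, r₃, t₃, d₃⟩ := eval_readVector n 2 e s₂
  obtain ⟨s₄, h₄, i₄, r₄, t₄, d₄⟩ := eval_readVector n 3 e s₃
  obtain ⟨s₅, h₅, i₅, r₅, t₅, d₅⟩ := eval_readMatrix n 4 e s₄
  refine ⟨_, rfl, ?_, ?_⟩
  · simp only [readGame, readEnd, Prog.eval, h₁, h₂, h₃, h₄, h₅, Function.update_self, r₅, r₄, r₃,
      r₂, r₁, i₅, i₄, i₃, i₂, i₁, List.length_drop, Bool.or_eq_false_iff, decide_eq_false_iff_not,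
      List.drop_drop, List.head?_drop, Option.isSome_eq_false_iff, Option.isNone_iff_eq_none,
      List.getElem?_eq_none_iff, and_assoc]
    refine and_congr_right fun _ => ?_
    omega
  · simp only [readGame, readEnd, Prog.eval, h₁, h₂, h₃, h₄, h₅]
    rw [i₁] at i₂ d₂
    rw [i₂] at i₃ d₃
    rw [i₃] at i₄ d₄
    rw [i₄] at d₅
    refine ⟨?_, fun v hv => ?_, fun v hv => ?_, fun v hv => ?_, fun v hv => ?_, d₅⟩
    · rw [t₅ _ (by decide), t₄ _ (by decide), t₃ _ (by decide), t₂ _ (by decide),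
        t₁ _ (by decide)]
    · rw [t₅ _ (by decide), t₄ _ (by decide), t₃ _ (by decide), t₂ _ (by decide), d₁ v hv]
    · rw [t₅ _ (by decide), t₄ _ (by decide), t₃ _ (by decide), d₂ v hv]
    · rw [t₅ _ (by decide), t₄ _ (by decide), d₃ v hv]
    · rw [t₅ _ (by decide), d₄ v hv]

theorem encode_eq_iff {n : ℕ} (G : OneLargeTargetGame (Fin n)) (e : Env) (s : State)
    (hs : s.reg 0 = false) :
    G.encode = List.replicate n true ++ false :: s.inp ↔ (readGame.eval n e s).reg 0 = false ∧
      Represents (readGame.eval n e s).tab G.arena {G.start} G.F₀ G.T := by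
  classical
  obtain ⟨s', h, h0, -, h1, h2, h3, h4, h5⟩ := eval_readGame n e s
  rw [h, h0]
  simp only [OneLargeTargetGame.encode, List.append_assoc, List.append_cancel_left_eq,
    List.cons_append, List.nil_append, List.cons.injEq, true_and]
  rw [List.ofFn_decide_append_eq_iff (fun v => v ∈ G.arena.eve),
    List.ofFn_decide_append_eq_iff (fun v => v = G.start),
    List.ofFn_decide_append_eq_iff (fun v => v ∈ G.F₀),
    List.ofFn_decide_append_eq_iff (fun v => v ∈ G.T), List.flatten_ofFn_decide_eq_iff]
  constructor
  · rintro ⟨l₁, e₁, l₂, e₂, l₃, e₃, l₄, e₄, l₅, e₅, l₆⟩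
    refine ⟨⟨hs, ?_⟩, fun v => ?_, fun v => ?_, fun v => ?_, fun v => ?_, fun u v => ?_⟩
    · have := congrArg List.length l₆
      simp only [List.length_drop, List.length_nil] at *
      omega
    · rw [h1 v v.2, e₁]
    · rw [h2 v v.2, e₂]; rfl
    · rw [h3 v v.2, e₃]
    · rw [h4 v v.2, e₄]
    · rw [h5 u u.2 v v.2, e₅]
  · rintro ⟨⟨-, hlen⟩, r⟩
    refine ⟨by omega, fun v => ?_, ?_, fun v => ?_, ?_, fun v => ?_, ?_, fun v => ?_, ?_,
      fun u v => ?_, ?_⟩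
    · rw [← h1 v v.2, r.eve]
    · simp; omega
    · rw [← h2 v v.2, r.start]; rfl
    · simp; omega
    · rw [← h3 v v.2, r.large]
    · simp; omega
    · rw [← h4 v v.2, r.singles]
    · simp; omega
    · rw [← h5 u u.2 v v.2, r.edge]
    · rw [eq_comm, ← List.length_eq_zero_iff]; simp; omega

/-- The answer of the program. -/
def accepts (r : Reg) : Bool := !r 0 && r 1

theorem accepts_iff (n : ℕ) (w : List Bool) (hw : w.head? ≠ some true) :
    accepts ((Prog.seq readGame solveGame).eval n (fun _ => 0) (.initial w)).reg = true ↔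
      List.replicate n true ++ w ∈ oneLargeTargetGenReach := by
  classical
  set e : Env := fun _ => 0
  set s := readGame.eval n e (.initial w) with hs
  have h8 : s.tab 8 = fun _ _ => false := by
    obtain ⟨s', h, -, h', -⟩ := eval_readGame n e (.initial w)
    rw [hs, h, h']
    rfl
  have hreg : (State.initial w).reg 0 = false := rfl
  change (!(solveGame.eval n e s).reg 0 && (solveGame.eval n e s).reg 1) = true ↔ _
  rw [Bool.and_eq_true, Bool.not_eq_true']
  constructor
  · rintro ⟨h0, h1⟩
    -- The game is rebuilt from the tables; the validity check supplies its start vertex and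
    -- `one_lt_card`.
    let A : GameArena (Fin n) := ⟨fun u v => s.tab 4 u v = true, {v | s.tab 0 v v = true}⟩
    let F : Finset (Fin n) := {v | s.tab 2 v v = true}
    let T : Finset (Fin n) := {v | s.tab 3 v v = true}
    have hrep : Represents s.tab A {v | s.tab 1 v v = true} F T :=
      ⟨fun v => Iff.rfl, fun v => Iff.rfl, fun v => by simp [F], fun v => by simp [T],
        fun u v => Iff.rfl⟩
    obtain ⟨hr0, hr1⟩ := eval_solveGame e s hrep h8
    obtain ⟨⟨⟨x, hx, y, hy, hxy⟩, ⟨a, ha⟩, huniq⟩, hc, hst, hreach⟩ := hr1.1 h1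
    have hS : {v : Fin n | s.tab 1 v v = true} = {a} :=
      Set.eq_singleton_iff_unique_mem.2 ⟨ha, fun b hb => huniq b hb a ha⟩
    rw [hS] at hrep hst hreach
    let G : OneLargeTargetGame (Fin n) :=
      ⟨A, a, F, T, Finset.one_lt_card.2 ⟨x, hx, y, hy, hxy⟩⟩
    have henc : G.encode = List.replicate n true ++ false :: (State.initial w).inp :=
      (encode_eq_iff G e _ hreg).2 ⟨hr0 ▸ h0, hrep⟩
    refine ⟨n, G, ?_, G.eveWins_iff_criterion_withLoops.2
      ⟨hc, fun t ht => hst a rfl t ht, hreach⟩⟩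
    -- Taking the tail hides whether the separator was present. An empty `w` is excluded by length:
    -- `F₀` has an element, so `n > 0` and bits must follow the separator.
    cases w with
    | nil =>
      have hlen := congrArg List.length henc
      have hn : 0 < n := x.pos
      simp [OneLargeTargetGame.encode, State.initial] at hlen
      omega
    | cons b w =>
      obtain rfl : b = false := by simpa using hw
      exact henc
  · rintro ⟨m, G, henc, hwin⟩
    obtain ⟨l, hl⟩ : ∃ l, G.encode = List.replicate m true ++ false :: l := by
      simp [OneLargeTargetGame.encode]
    obtain ⟨rfl, rfl⟩ := (List.replicate_append_eq_iff hw).1 (hl.symm.trans henc)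
    obtain ⟨h0, hrep⟩ := (encode_eq_iff G e (.initial (false :: l)) hreg).1 henc
    obtain ⟨hr0, hr1⟩ := eval_solveGame e s hrep h8
    refine ⟨hr0.trans h0, hr1.2 ?_⟩
    have hC := G.eveWins_iff_criterion_withLoops.1 hwin
    obtain ⟨x, hx, y, hy, hxy⟩ := Finset.one_lt_card.1 G.one_lt_card
    refine ⟨⟨⟨x, hx, y, hy, hxy⟩, ⟨_, rfl⟩, fun x hx y hy => hx.trans hy.symm⟩, hC.comparable,
      ?_, hC.reach⟩
    rintro x rfl t ht
    exact hC.start_mem t ht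

end GridMachine

/-! ### The main theorem -/

theorem oneLargeTargetGenReach_inP : InP oneLargeTargetGenReach :=
  GridMachine.inP_of_prog _ _ GridMachine.wellFormed_program GridMachine.free_program
    GridMachine.accepts GridMachine.accepts_iff

theorem mainTheorem5 :
    InP oneLargeTargetGenReach ∧
    ∀ {V : Type*} [Finite V] (G : OneLargeTargetGame V),
      (∀ v ∈ G.arena.adam, (G.arena.succ v).Nonempty) →
        (G.EveWins ↔ G.AttractorsFormChain ∧
          ∃ e : Fin G.T.card → V, G.IsDescendingEnumeration e ∧
            G.StartInSmallest e ∧ G.SomeTargetReachesF₀ e) ∧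
        (G.EveWins ↔ G.AttractorsFormChain ∧
          ∀ e : Fin G.T.card → V, G.IsDescendingEnumeration e →
            G.StartInSmallest e ∧ G.SomeTargetReachesF₀ e) :=
  ⟨oneLargeTargetGenReach_inP, fun _ hA =>
    ⟨OneLargeTargetGame.eveWins_iff_exists_enumeration hA,
      OneLargeTargetGame.eveWins_iff_forall_enumeration hA⟩⟩
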